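/- Let $\Bbbk$ be a field. A *variety* over a field $K$ is an integral separated scheme of finite type over $K$ (not necessarily geometrically integral). Let $\mathrm{Burn}(\Bbbk)$ be the free abelian group on the birational isomorphism classes of $\Bbbk$-varieties. *The motivic invariant.* For a birational map $\phi\colon X_1\dashrightarrow X_2$ let $\mathrm{ExDiv}(\phi)$ be the (finite) set of prime divisors $D\subset X_1$ such that $\phi$ is not a local isomorphism at the generic point of $D$. For a birational map $\phi$ of $\Bbbk$-varieties put $$c(\phi)=\sum_{E\in \mathrm{ExDiv}(\phi^{-1})}[E]-\sum_{D\in \mathrm{ExDiv}(\phi)}[D]\in \mathrm{Burn}(\Bbbk).$$ *Relative version.* Consider pairs $X/F$ where $F$ is a finitely generated field extension of $\Bbbk$ and $X$ is a variety over $F$. A morphism $X_1/F_1\dashrightarrow X_2/F_2$ is an isomorphism $\operatorname{Spec}F_1\cong\operatorname{Spec}F_2$ over $\Bbbk$ together with a birational map $X_1\dashrightarrow X_2$ over it. Let $\mathcal{B}urn(\Bbbk)$ be the free abelian group on the isomorphism classes $[X/F]$. For a morphism $\phi\colon X_1/F_1\dashrightarrow X_2/F_2$ put $$c(\phi)=\sum_{E\in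 \mathrm{ExDiv}(\phi^{-1})}[E/F_2]-\sum_{D\in \mathrm{ExDiv}(\phi)}[D/F_1]\in\mathcal{B}urn(\Bbbk).$$ The forgetful homomorphism $\mathcal{B}urn(\Bbbk)\to \mathrm{Burn}(\Bbbk)$ sends $[X/F]$ to the birational class of the $\Bbbk$-varieties with function field $F(X)$. *Horizontal and vertical invariants.* Let $\pi\colon X\to B$ be a dominant morphism of $\Bbbk$-varieties. Let $\mathrm{Bir}(B)$ be the group of birational automorphisms of $B$ over $\Bbbk$, and let $\mathrm{Bir}(\pi)$ be the group of birational automorphisms $\phi$ of $X$ over $\Bbbk$ such that $\pi\circ\phi=\sigma\circ\pi$ as rational maps for some (necessarily unique) $\sigma\in\mathrm{Bir}(B)$. Each $\phi\in\mathrm{Bir}(\pi)$ induces an automorphism $\phi^\eta$, in the above sense, of the generic fibre $X_\eta/\Bbbk(B)$. Let $c_{\mathrm{hor}}(\phi)\in\mathrm{Burn}(\Bbbk)$ be the image of $c(\phi^\eta)$ under the forgetful homomorphism, and put $c_{\mathrm{ver}}(\phi)=c(\phi)-c_{\mathrm{hor}}(\phi)$. *Birational triviality.* The morphism $\pi$ is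 *birationally trivial in codimension one* if $X$ and $B$ are normal, $\pi$ is flat, and there is a $\Bbbk$-variety $F$ such that, for all but finitely many prime divisors $D$ of $B$, the preimage $\pi^{-1}(D)$ is irreducible and birational to $D\times_{\Bbbk}F$ over $D$ (both taken with their reduced structure). **Corollary (Vanishing III).** If $\pi\colon X\to B$ is birationally trivial in codimension one and $c(\sigma)=0$ for all $\sigma\in \mathrm{Bir}(B)$, then $c_{\mathrm{ver}}(\phi)=0$ for all $\phi\in \mathrm{Bir}(\pi)$. -/

import Mathlib

universe u

open AlgebraicGeometry CategoryTheory CategoryTheory.Limits TopologicalSpace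

namespace MotivicBir


theorem isReduced_vanishingIdeal_subscheme {X : Scheme.{u}} (Z : Closeds X) :
    IsReduced (Scheme.IdealSheafData.vanishingIdeal Z).subscheme := by
  let I := Scheme.IdealSheafData.vanishingIdeal Z
  have h : ∀ U, IsReduced (I.subschemeCover.openCover.X U) := by
    intro U
    have : _root_.IsReduced (Γ(X, U.1) ⧸ I.ideal U) := by
      rw [← Ideal.isRadical_iff_quotient_reduced]
      exact PrimeSpectrum.isRadical_vanishingIdeal _
    exact inferInstanceAs (IsReduced (Spec (.of (Γ(X, U.1) ⧸ I.ideal U))))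
  exact IsReduced.of_openCover _ I.subschemeCover.openCover

theorem isIntegral_vanishingIdeal_closure {X : Scheme.{u}} (x : X) :
    IsIntegral (Scheme.IdealSheafData.vanishingIdeal (Closeds.closure {x})).subscheme := by
  have := isReduced_vanishingIdeal_subscheme (X := X) (Closeds.closure {x})
  let I := Scheme.IdealSheafData.vanishingIdeal (X := X) (Closeds.closure {x})
  have hr : IsIrreducible (I.support : Set X) := by
    have : (I.support : Set X) = closure {x} := by simp [I]
    rw [this]
    exact isIrreducible_singleton.closure
  have : IrreducibleSpace I.subscheme := Subtype.irreducibleSpace hr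
  exact isIntegral_of_irreducibleSpace_of_isReduced _

theorem flat_fromSpecStalk {X : Scheme.{u}} (x : X) : Flat (X.fromSpecStalk x) := by
  obtain ⟨_, ⟨U, hU, rfl⟩, hxU, -⟩ :=
    X.isBasis_affineOpens.exists_subset_of_mem_open (Set.mem_univ x) isOpen_univ
  rw [← hU.fromSpecStalk_eq_fromSpecStalk hxU]
  have : Flat (Spec.map (X.presheaf.germ U x hxU)) := by
    rw [Flat.SpecMap_iff]
    let := TopCat.Presheaf.algebra_section_stalk X.presheaf (⟨x, hxU⟩ : U)
    have := hU.isLocalization_stalk ⟨x, hxU⟩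
    have h := IsLocalization.flat (R := Γ(X, U)) (X.presheaf.stalk x)
      (hU.primeIdealOf ⟨x, hxU⟩).asIdeal.primeCompl
    exact h
  have h1 := hU.isOpenImmersion_fromSpec
  have h2 : Flat hU.fromSpec := inferInstance
  have : Flat (Spec.map (X.presheaf.germ U x hxU) ≫ hU.fromSpec) :=
    MorphismProperty.comp_mem @Flat _ _ this h2
  exact this

theorem flat_fromSpecResidueField_genericPoint {B : Scheme.{u}} [IsIntegral B] :
    Flat (B.fromSpecResidueField (genericPoint B)) := by
  have := flat_fromSpecStalk (genericPoint B)
  have : IsIso (B.residue (genericPoint B)) := by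
    have : Function.Bijective (B.residue (genericPoint B)).hom :=
      ⟨RingHom.injective (R := B.functionField) _, B.residue_surjective _⟩
    exact (ConcreteCategory.isIso_iff_bijective _).mpr this
  unfold Scheme.fromSpecResidueField
  infer_instance

theorem apply_genericPoint_of_isDominant {X B : Scheme.{u}} [IsIntegral X] [IsIntegral B]
    (f : X ⟶ B) [IsDominant f] : f (genericPoint X) = genericPoint B := by
  apply IsGenericPoint.eq _ (genericPoint_spec B)
  have h := (genericPoint_spec X).image f.continuous
  rwa [Set.image_univ, f.denseRange.closure_eq] at h

theorem irreducibleSpace_of_inducing {Y X : Type*} [TopologicalSpace Y] [TopologicalSpace X]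
    {f : Y → X} (hf : Topology.IsInducing f) (g : Y) (h : ∀ y, f g ⤳ f y) :
    IrreducibleSpace Y := by
  rw [irreducibleSpace_def]
  have : closure {g} = (Set.univ : Set Y) :=
    Set.eq_univ_of_forall fun y ↦ (hf.specializes_iff.mp (h y)).mem_closure
  change IsIrreducible (Set.univ : Set Y)
  rw [← this]
  exact isIrreducible_singleton.closure

theorem isIntegral_fiber_genericPoint {X B : Scheme.{u}} [IsIntegral X] [IsIntegral B]
    (f : X ⟶ B) [IsDominant f] : IsIntegral (f.fiber (genericPoint B)) := by
  have hred : IsReduced (f.fiber (genericPoint B)) := by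
    have := flat_fromSpecResidueField_genericPoint (B := B)
    have hfl : Flat (f.fiberι (genericPoint B)) :=
      inferInstanceAs (Flat (pullback.fst f (B.fromSpecResidueField (genericPoint B))))
    have : ∀ y, _root_.IsReduced ((f.fiber (genericPoint B)).presheaf.stalk y) := by
      intro y
      let φ := ((f.fiberι (genericPoint B)).stalkMap y).hom
      have h1 : Function.Surjective φ := (f.fiberι (genericPoint B)).stalkMap_surjective y
      have h2 : φ.Flat := Flat.stalkMap _ y
      have h3 : IsLocalHom φ := inferInstance
      have h4 : Function.Injective φ := by
        let := φ.toAlgebra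
        have : Module.Flat (X.presheaf.stalk (f.fiberι (genericPoint B) y))
          ((f.fiber (genericPoint B)).presheaf.stalk y) := h2
        have : IsLocalHom (algebraMap (X.presheaf.stalk (f.fiberι (genericPoint B) y))
          ((f.fiber (genericPoint B)).presheaf.stalk y)) := h3
        have := Module.FaithfullyFlat.of_flat_of_isLocalHom
          (A := X.presheaf.stalk (f.fiberι (genericPoint B) y))
          (B := (f.fiber (genericPoint B)).presheaf.stalk y)
        exact FaithfulSMul.algebraMap_injective _ _
      let e := RingEquiv.ofBijective φ ⟨h4, h1⟩
      exact isReduced_of_injective e.symm e.symm.injective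
    exact isReduced_of_isReduced_stalk _
  have : IrreducibleSpace (f.fiber (genericPoint B)) := by
    have hg : genericPoint X ∈ Set.range (f.fiberι (genericPoint B)) := by
      rw [f.range_fiberι]
      exact apply_genericPoint_of_isDominant f
    obtain ⟨g, hg⟩ := hg
    refine irreducibleSpace_of_inducing (f.fiberι (genericPoint B)).isEmbedding.isInducing g ?_
    intro y
    rw [hg]
    exact (genericPoint_spec X).specializes trivial
  exact isIntegral_of_irreducibleSpace_of_isReduced _

theorem essFiniteType_toStalk (R : CommRingCat.{u}) (p : PrimeSpectrum R) :
    (StructureSheaf.toStalk R p).hom.EssFiniteType := by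
  let := StructureSheaf.stalkAlgebra R p
  have := StructureSheaf.IsLocalization.to_stalk R p
  exact Algebra.EssFiniteType.of_isLocalization
    ((AlgebraicGeometry.Spec.structureSheaf R).presheaf.stalk p) p.asIdeal.primeCompl

theorem essFiniteType_of_locallyOfFiniteType {X : Scheme.{u}} {R : CommRingCat.{u}}
    (f : X ⟶ Spec R) [LocallyOfFiniteType f] (x : X) :
    (Spec.preimage (X.fromSpecStalk x ≫ f)).hom.EssFiniteType := by
  have h : Spec.preimage (X.fromSpecStalk x ≫ f) =
      ((Scheme.ΓSpecIso R).inv ≫ (Spec R).presheaf.germ ⊤ (f x) trivial) ≫ f.stalkMap x := by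
    apply Spec.map_injective
    rw [Spec.map_preimage, Spec.map_comp, ← Spec.fromSpecStalk_eq,
      Scheme.SpecMap_stalkMap_fromSpecStalk]
  rw [h, CommRingCat.hom_comp]
  refine RingHom.EssFiniteType.comp ?_ (LocallyOfFiniteType.stalkMap f x)
  exact essFiniteType_toStalk R (f x)

theorem essFiniteType_residueField {X : Scheme.{u}} {R : CommRingCat.{u}}
    (f : X ⟶ Spec R) [LocallyOfFiniteType f] (x : X) :
    (Spec.preimage (X.fromSpecResidueField x ≫ f)).hom.EssFiniteType := by
  have h : Spec.preimage (X.fromSpecResidueField x ≫ f) =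
      Spec.preimage (X.fromSpecStalk x ≫ f) ≫ X.residue x := by
    apply Spec.map_injective
    simp [Scheme.fromSpecResidueField]
  rw [h, CommRingCat.hom_comp]
  refine RingHom.EssFiniteType.comp (essFiniteType_of_locallyOfFiniteType f x) ?_
  exact (RingHom.FiniteType.of_surjective _ (X.residue_surjective x)).essFiniteType


theorem fromSpecStalk_genericPoint_apply {X : Scheme.{u}} [IsIntegral X]
    (p : Spec X.functionField) : X.fromSpecStalk _ p = genericPoint X := by
  have : p = IsLocalRing.closedPoint X.functionField :=
    Subsingleton.elim (α := PrimeSpectrum X.functionField) _ _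
  rw [this]
  exact Scheme.fromSpecStalk_closedPoint

theorem fromSpecStalkOfMem_genericPoint_apply {X : Scheme.{u}} [IsIntegral X] (U : X.Opens)
    (hU : genericPoint X ∈ U) (p : Spec X.functionField) :
    U.fromSpecStalkOfMem _ hU p = ⟨genericPoint X, hU⟩ := by
  apply U.ι.isOpenEmbedding.injective
  rw [← Scheme.Hom.comp_apply, Scheme.Opens.fromSpecStalkOfMem_ι,
    fromSpecStalk_genericPoint_apply]
  rfl

theorem spread_aux {X Y S : Scheme.{u}} [IsIntegral X] [IsIntegral Y]
    (sX : X ⟶ S) (sY : Y ⟶ S) [IsSeparated sX] (U : X.Opens) (V : Y.Opens)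
    (f : U.toScheme ⟶ Y) (g : V.toScheme ⟶ X) (hf : f ≫ sY = U.ι ≫ sX) (hg : g ≫ sX = V.ι ≫ sY)
    (hU : genericPoint X ∈ U) (hV : genericPoint Y ∈ V)
    (φ : Spec X.functionField ⟶ Spec Y.functionField)
    (ψ : Spec Y.functionField ⟶ Spec X.functionField) (h : φ ≫ ψ = 𝟙 _)
    (hfs : U.fromSpecStalkOfMem _ hU ≫ f = φ ≫ Y.fromSpecStalk _)
    (hgs : V.fromSpecStalkOfMem _ hV ≫ g = ψ ≫ X.fromSpecStalk _)
    (U' : X.Opens) (hU' : U' ≤ U) (hmem : genericPoint X ∈ U') (a : U'.toScheme ⟶ V.toScheme)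
    (ha : a ≫ V.ι = X.homOfLE hU' ≫ f) : a ≫ g = U'.ι := by
  have hj : U'.fromSpecStalkOfMem _ hmem ≫ X.homOfLE hU' = U.fromSpecStalkOfMem _ hU := by
    simp [← cancel_mono U.ι]
  have hja : U'.fromSpecStalkOfMem _ hmem ≫ a = φ ≫ V.fromSpecStalkOfMem _ hV := by
    rw [← cancel_mono V.ι, Category.assoc, ha, reassoc_of% hj, hfs, Category.assoc,
      Scheme.Opens.fromSpecStalkOfMem_ι]
  have : Nonempty U' := ⟨⟨_, hmem⟩⟩
  have hdom : IsDominant (U'.fromSpecStalkOfMem _ hmem) := by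
    refine ⟨?_⟩
    have hx : (⟨genericPoint X, hmem⟩ : U') = genericPoint U' := by
      apply U'.ι.isOpenEmbedding.injective
      rw [genericPoint_eq_of_isOpenImmersion U'.ι]
      rfl
    have h2 : closure {genericPoint U'} = Set.univ := genericPoint_spec U'
    refine Dense.mono (s₁ := {genericPoint U'}) ?_ (dense_iff_closure_eq.mpr h2)
    rintro _ rfl
    exact ⟨(⟨⊥, Ideal.isPrime_bot⟩ : PrimeSpectrum X.functionField),
      (fromSpecStalkOfMem_genericPoint_apply U' hmem _).trans hx⟩
  refine ext_of_isDominant_of_isSeparated sX ?_ (U'.fromSpecStalkOfMem _ hmem) ?_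
  · rw [Category.assoc, hg, reassoc_of% ha, hf]
    simp
  · rw [reassoc_of% hja, hgs, reassoc_of% h]
    simp

theorem spread_mem {X Y : Scheme.{u}} [IsIntegral X] [IsIntegral Y]
    (U : X.Opens) (V : Y.Opens) (f : U.toScheme ⟶ Y)
    (hU : genericPoint X ∈ U) (hV : genericPoint Y ∈ V)
    (φ : Spec X.functionField ⟶ Spec Y.functionField)
    (hfs : U.fromSpecStalkOfMem _ hU ≫ f = φ ≫ Y.fromSpecStalk _) :
    genericPoint X ∈ U.ι ''ᵁ f ⁻¹ᵁ V := by
  let p : Spec X.functionField := (⟨⊥, Ideal.isPrime_bot⟩ : PrimeSpectrum X.functionField)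
  refine ⟨⟨genericPoint X, hU⟩, ?_, rfl⟩
  change f _ ∈ V
  rw [← fromSpecStalkOfMem_genericPoint_apply U hU p, ← Scheme.Hom.comp_apply, hfs,
    Scheme.Hom.comp_apply, fromSpecStalk_genericPoint_apply]
  exact hV

theorem spread_exists {X Y : Scheme.{u}}
    (U : X.Opens) (V : Y.Opens) (f : U.toScheme ⟶ Y) (g : V.toScheme ⟶ X) 
    (h : ∀ a : (U.ι ''ᵁ f ⁻¹ᵁ V).toScheme ⟶ V.toScheme,
      a ≫ V.ι = X.homOfLE (U.ι_image_le _) ≫ f → a ≫ g = (U.ι ''ᵁ f ⁻¹ᵁ V).ι) :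
    ∃ a : (U.ι ''ᵁ f ⁻¹ᵁ V).toScheme ⟶ (V.ι ''ᵁ g ⁻¹ᵁ U).toScheme,
      a ≫ Y.homOfLE (V.ι_image_le _) ≫ g = (U.ι ''ᵁ f ⁻¹ᵁ V).ι ∧ 
      a ≫ (V.ι ''ᵁ g ⁻¹ᵁ U).ι = X.homOfLE (U.ι_image_le _) ≫ f := by
  have h1 : Set.range (X.homOfLE (U.ι_image_le (f ⁻¹ᵁ V)) ≫ f) ⊆ Set.range V.ι := by
    rintro _ ⟨x, rfl⟩
    obtain ⟨y, hy, hyx⟩ := x.2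
    have hxy : X.homOfLE (U.ι_image_le (f ⁻¹ᵁ V)) x = y := by
      apply U.ι.isOpenEmbedding.injective
      rw [← Scheme.Hom.comp_apply, Scheme.homOfLE_ι]
      exact hyx.symm
    rw [Scheme.Opens.range_ι, Scheme.Hom.comp_apply, hxy]
    exact hy
  let a := IsOpenImmersion.lift V.ι _ h1
  have ha : a ≫ V.ι = _ := IsOpenImmersion.lift_fac V.ι _ h1
  have hag := h a ha
  have h2 : Set.range a ⊆ Set.range (Y.homOfLE (V.ι_image_le (g ⁻¹ᵁ U))) := by
    rintro _ ⟨x, rfl⟩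
    have : g (a x) ∈ U := by
      rw [← Scheme.Hom.comp_apply, hag]
      obtain ⟨_, y, hy, rfl⟩ := x
      exact y.2
    exact ⟨⟨(a x).1, a x, this, rfl⟩, by apply Subtype.ext; simp⟩
  refine ⟨IsOpenImmersion.lift (Y.homOfLE (V.ι_image_le (g ⁻¹ᵁ U))) a h2, ?_, ?_⟩
  · rw [IsOpenImmersion.lift_fac_assoc, hag]
  · rw [← Y.homOfLE_ι (V.ι_image_le (g ⁻¹ᵁ U)), IsOpenImmersion.lift_fac_assoc, ha]

theorem birationalOver_of_functionField {X Y S : Scheme.{u}} [IsIntegral X] [IsIntegral Y]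
    (sX : X ⟶ S) (sY : Y ⟶ S) [LocallyOfFiniteType sX] [LocallyOfFiniteType sY]
    [IsSeparated sX] [IsSeparated sY]
    (e : Spec X.functionField ≅ Spec Y.functionField)
    (he : e.hom ≫ Y.fromSpecStalk _ ≫ sY = X.fromSpecStalk _ ≫ sX) :
    Scheme.BirationalOver sX sY := by
  have he' : e.inv ≫ X.fromSpecStalk _ ≫ sX = Y.fromSpecStalk _ ≫ sY := by
    rw [← he, e.inv_hom_id_assoc]
  obtain ⟨U, hUd, f, hU, hf, hfs⟩ : ∃ (U : X.Opens) (_ : Dense (U : Set X)) (f : U.toScheme ⟶ Y)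
      (hU : genericPoint X ∈ U), f ≫ sY = U.ι ≫ sX ∧
      U.fromSpecStalkOfMem _ hU ≫ f = e.hom ≫ Y.fromSpecStalk _ := by
    let f := Scheme.PartialMap.ofFromSpecStalk sX sY (e.hom ≫ Y.fromSpecStalk _)
      (by simpa using he)
    exact ⟨f.domain, f.dense_domain, f.hom, Scheme.PartialMap.mem_domain_ofFromSpecStalk _ _ _ _,
      Scheme.PartialMap.ofFromSpecStalk_comp _ _ _ _,
      Scheme.PartialMap.fromSpecStalkOfMem_ofFromSpecStalk _ _ _ _⟩
  obtain ⟨V, hVd, g, hV, hg, hgs⟩ : ∃ (V : Y.Opens) (_ : Dense (V : Set Y)) (g : V.toScheme ⟶ X)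
      (hV : genericPoint Y ∈ V), g ≫ sX = V.ι ≫ sY ∧
      V.fromSpecStalkOfMem _ hV ≫ g = e.inv ≫ X.fromSpecStalk _ := by
    let f := Scheme.PartialMap.ofFromSpecStalk sY sX (e.inv ≫ X.fromSpecStalk _)
      (by simpa using he')
    exact ⟨f.domain, f.dense_domain, f.hom, Scheme.PartialMap.mem_domain_ofFromSpecStalk _ _ _ _,
      Scheme.PartialMap.ofFromSpecStalk_comp _ _ _ _,
      Scheme.PartialMap.fromSpecStalkOfMem_ofFromSpecStalk _ _ _ _⟩
  have hXm := spread_mem U V f hU hV e.hom hfs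
  have hYm := spread_mem V U g hV hU e.inv hgs
  obtain ⟨a, ha1, ha2⟩ := spread_exists U V f g fun a ha ↦
    spread_aux sX sY U V f g hf hg hU hV e.hom e.inv e.hom_inv_id hfs hgs _ _ hXm a ha
  obtain ⟨b, hb1, hb2⟩ := spread_exists V U g f fun a ha ↦
    spread_aux sY sX V U g f hg hf hV hU e.inv e.hom e.inv_hom_id hgs hfs _ _ hYm a ha
  refine ⟨⟨_, (U.ι ''ᵁ f ⁻¹ᵁ V).2.dense ⟨_, hXm⟩, _, (V.ι ''ᵁ g ⁻¹ᵁ U).2.dense ⟨_, hYm⟩,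
    ⟨a, b, ?_, ?_⟩⟩, ?_⟩
  · rw [← cancel_mono (U.ι ''ᵁ f ⁻¹ᵁ V).ι, Category.assoc, hb2, ha1, Category.id_comp]
  · rw [← cancel_mono (V.ι ''ᵁ g ⁻¹ᵁ U).ι, Category.assoc, ha2, hb1, Category.id_comp]
  · change a ≫ _ ≫ sY = _ ≫ sX
    rw [reassoc_of% ha2, hf]
    simp

theorem exists_functionField_iso (A : CommRingCat.{u}) [IsDomain A] {K : Type u} [Field K]
    (j : A ⟶ .of K) (hj : Function.Injective j.hom)
    (hj' : ∀ z : K, ∃ x y : A, z = j.hom x / j.hom y) :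
    ∃ e : Spec (Spec A).functionField ≅ Spec (.of K),
      e.hom ≫ Spec.map j = (Spec A).fromSpecStalk _ := by
  let := j.hom.toAlgebra
  have : FaithfulSMul A K := (faithfulSMul_iff_algebraMap_injective A K).mpr hj
  have : IsFractionRing A K := IsFractionRing.of_field A K fun z ↦ by
    obtain ⟨x, y, h⟩ := hj' z
    exact ⟨x, y, h⟩
  let e1 : K ≃ₐ[A] (Spec A).functionField :=
    IsLocalization.algEquiv (nonZeroDivisors A) K (Spec A).functionField
  refine ⟨Scheme.Spec.mapIso (e1.toRingEquiv.toCommRingCatIso).op, ?_⟩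
  have h : j ≫ e1.toRingEquiv.toCommRingCatIso.hom =
      (Scheme.ΓSpecIso A).inv ≫ (Spec A).presheaf.germ ⊤ (genericPoint (Spec A)) trivial := by
    ext a
    exact e1.commutes a
  rw [Spec.fromSpecStalk_eq, ← h, Spec.map_comp]
  rfl

theorem exists_model {K : Type u} [Field K] (R : CommRingCat.{u}) (i : R ⟶ .of K)
    (hi : i.hom.EssFiniteType) : ∃ (Y : Scheme.{u}) (s : Y ⟶ Spec R) (_ : IsIntegral Y)
      (_ : IsSeparated s) (_ : LocallyOfFiniteType s) (_ : QuasiCompact s)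
      (e : Spec Y.functionField ≅ Spec (.of K)), e.hom ≫ Spec.map i = Y.fromSpecStalk _ ≫ s := by
  let := i.hom.toAlgebra
  have : Algebra.EssFiniteType R K := hi
  let A := Algebra.EssFiniteType.subalgebra R K
  let j : CommRingCat.of A ⟶ .of K := CommRingCat.ofHom A.val.toRingHom
  let s : Spec (.of A) ⟶ Spec R := Spec.map (CommRingCat.ofHom (algebraMap R A))
  have hft : LocallyOfFiniteType s := by
    refine HasRingHomProperty.Spec_iff.mpr ?_
    exact (RingHom.finiteType_algebraMap (A := R) (B := A)).mpr inferInstance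
  obtain ⟨e, he⟩ := exists_functionField_iso (.of A) j Subtype.val_injective fun z ↦ by
    obtain ⟨⟨x, y⟩, h⟩ := IsLocalization.surj (Algebra.EssFiniteType.submonoid R K) z
    have hy : IsUnit (algebraMap A K y) := IsLocalization.map_units K y
    exact ⟨x, y.1, (eq_div_iff hy.ne_zero).mpr h⟩
  refine ⟨Spec (.of A), s, inferInstance, inferInstance, hft, inferInstance, e, ?_⟩
  rw [← he, Category.assoc, ← Spec.map_comp]
  rfl


theorem exists_lift_residueField {X : Scheme.{u}} {K : Type u} [Field K] (g : Spec (.of K) ⟶ X)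
    (x : X) (h : ∀ p, g p = x) : ∃ t : Spec (.of K) ⟶ Spec (X.residueField x),
      t ≫ X.fromSpecResidueField x = g := by
  obtain rfl : g (IsLocalRing.closedPoint K) = x := h _
  exact ⟨_, Scheme.descResidueField_stalkClosedPointTo_fromSpecResidueField K X g⟩

theorem exists_lift_genericPoint {B₁ B₂ : Scheme.{u}} [IsIntegral B₁] [IsIntegral B₂] (U : B₁.Opens)
    (hU : genericPoint B₁ ∈ U) (σ : U.toScheme ⟶ B₂) [IsOpenImmersion σ] :
    ∃ (j : Spec (B₁.residueField (genericPoint B₁)) ⟶ U.toScheme)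
      (t : Spec (B₁.residueField (genericPoint B₁)) ⟶ Spec (B₂.residueField (genericPoint B₂))),
      j ≫ U.ι = B₁.fromSpecResidueField _ ∧ t ≫ B₂.fromSpecResidueField _ = j ≫ σ := by
  have hr : Set.range (B₁.fromSpecResidueField (genericPoint B₁)) ⊆ Set.range U.ι := by
    rw [Scheme.range_fromSpecResidueField, Scheme.Opens.range_ι]
    rintro _ rfl
    exact hU
  let j := IsOpenImmersion.lift U.ι _ hr
  have hj : j ≫ U.ι = B₁.fromSpecResidueField _ := IsOpenImmersion.lift_fac _ _ _
  have : Nonempty U := ⟨⟨_, hU⟩⟩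
  obtain ⟨t, ht⟩ := exists_lift_residueField (K := B₁.residueField (genericPoint B₁)) (j ≫ σ)
    (genericPoint B₂) fun p ↦ by
      rw [Scheme.Hom.comp_apply, ← genericPoint_eq_of_isOpenImmersion σ]
      congr 1
      apply U.ι.isOpenEmbedding.injective
      rw [← Scheme.Hom.comp_apply, hj, genericPoint_eq_of_isOpenImmersion U.ι]
      exact Scheme.fromSpecResidueField_apply _ _
  exact ⟨j, t, hj, ht⟩

theorem isPullback_fiber_opens {X B : Scheme.{u}} (π : X ⟶ B) (b : B)
    (W : X.Opens) (V : B.Opens) (a : W.toScheme ⟶ V.toScheme) (ha : a ≫ V.ι = W.ι ≫ π)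
    (j : Spec (B.residueField b) ⟶ V.toScheme) (hj : j ≫ V.ι = B.fromSpecResidueField b) :
    IsPullback (π.fiberι b ∣_ W) ((π.fiberι b ⁻¹ᵁ W).ι ≫ π.fiberToSpecResidueField b) a j := by
  have h1 : IsPullback (π.fiberι b ∣_ W) (π.fiberι b ⁻¹ᵁ W).ι W.ι (π.fiberι b) := 
    isPullback_morphismRestrict (π.fiberι b) W
  have h2 : IsPullback (π.fiberι b) (π.fiberToSpecResidueField b) π (B.fromSpecResidueField b) :=
    IsPullback.of_hasPullback _ _
  have h3 := h1.paste_vert h2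
  rw [← ha, ← hj] at h3
  have w : (π.fiberι b ∣_ W) ≫ a = ((π.fiberι b ⁻¹ᵁ W).ι ≫ π.fiberToSpecResidueField b) ≫ j := by
    rw [← cancel_mono V.ι, Category.assoc, Category.assoc]
    exact h3.w
  exact ⟨⟨w⟩, ⟨PullbackCone.IsLimit.mk w
    (fun s ↦ h3.lift s.fst s.snd (by rw [reassoc_of% s.condition]))
    (fun s ↦ h3.lift_fst _ _ _) (fun s ↦ h3.lift_snd _ _ _)
    (fun s m hm1 hm2 ↦ h3.hom_ext (by rw [hm1, h3.lift_fst]) (by rw [hm2, h3.lift_snd]))⟩⟩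

/-- Isomorphic families have isomorphic generic fibres. -/
theorem exists_fiber_iso {X₁ X₂ B₁ B₂ : Scheme.{u}} [IsIntegral B₁] [IsIntegral B₂]
    (π₁ : X₁ ⟶ B₁) (π₂ : X₂ ⟶ B₂)
    (W₁ : X₁.Opens) (W₂ : X₂.Opens) (V₁ : B₁.Opens) (V₂ : B₂.Opens)
    (hV₁ : genericPoint B₁ ∈ V₁) (hV₂ : genericPoint B₂ ∈ V₂)
    (e : W₁.toScheme ≅ W₂.toScheme) (σ : V₁.toScheme ≅ V₂.toScheme)
    (a₁ : W₁.toScheme ⟶ V₁.toScheme) (ha₁ : a₁ ≫ V₁.ι = W₁.ι ≫ π₁)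
    (he : e.hom ≫ W₂.ι ≫ π₂ = a₁ ≫ σ.hom ≫ V₂.ι) :
    ∃ (τ : Spec (B₁.residueField (genericPoint B₁)) ≅ Spec (B₂.residueField (genericPoint B₂)))
      (j : Spec (B₁.residueField (genericPoint B₁)) ⟶ V₁.toScheme)
      (ψ : (π₁.fiberι (genericPoint B₁) ⁻¹ᵁ W₁).toScheme ≅
        (π₂.fiberι (genericPoint B₂) ⁻¹ᵁ W₂).toScheme),
      j ≫ V₁.ι = B₁.fromSpecResidueField _ ∧
      τ.hom ≫ B₂.fromSpecResidueField _ = j ≫ σ.hom ≫ V₂.ι ∧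
      ψ.hom ≫ (π₂.fiberι (genericPoint B₂) ⁻¹ᵁ W₂).ι ≫
          π₂.fiberToSpecResidueField (genericPoint B₂) =
        (π₁.fiberι (genericPoint B₁) ⁻¹ᵁ W₁).ι ≫
          π₁.fiberToSpecResidueField (genericPoint B₁) ≫ τ.hom ∧
      ψ.hom ≫ (π₂.fiberι (genericPoint B₂) ⁻¹ᵁ W₂).ι ≫ π₂.fiberι (genericPoint B₂) =
        (π₁.fiberι (genericPoint B₁) ∣_ W₁) ≫ e.hom ≫ W₂.ι := by
  obtain ⟨j₁, t₁, hj₁, ht₁⟩ := exists_lift_genericPoint V₁ hV₁ (σ.hom ≫ V₂.ι)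
  obtain ⟨j₂, t₂, hj₂, ht₂⟩ := exists_lift_genericPoint V₂ hV₂ (σ.inv ≫ V₁.ι)
  have htj₁ : t₁ ≫ j₂ = j₁ ≫ σ.hom := by
    rw [← cancel_mono V₂.ι, Category.assoc, hj₂, ht₁, Category.assoc]
  have htj₂ : t₂ ≫ j₁ = j₂ ≫ σ.inv := by
    rw [← cancel_mono V₁.ι, Category.assoc, hj₁, ht₂, Category.assoc]
  let τ : Spec (B₁.residueField (genericPoint B₁)) ≅ Spec (B₂.residueField (genericPoint B₂)) :=
    ⟨t₁, t₂, by
      rw [← cancel_mono (B₁.fromSpecResidueField _), Category.assoc, ht₂, reassoc_of% htj₁,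
        σ.hom_inv_id_assoc, hj₁, Category.id_comp], by
      rw [← cancel_mono (B₂.fromSpecResidueField _), Category.assoc, ht₁, reassoc_of% htj₂,
        σ.inv_hom_id_assoc, hj₂, Category.id_comp]⟩
  let a₂ : W₂.toScheme ⟶ V₂.toScheme := e.inv ≫ a₁ ≫ σ.hom
  have ha₂ : a₂ ≫ V₂.ι = W₂.ι ≫ π₂ := by
    simp only [a₂, Category.assoc]
    rw [← he, e.inv_hom_id_assoc]
  have h₁ := isPullback_fiber_opens π₁ _ W₁ V₁ a₁ ha₁ j₁ hj₁
  have h₂ := isPullback_fiber_opens π₂ _ W₂ V₂ a₂ ha₂ j₂ hj₂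
  have h₁' := h₁.of_iso (Iso.refl _) e τ σ (fst' := (π₁.fiberι _ ∣_ W₁) ≫ e.hom)
    (snd' := ((π₁.fiberι _ ⁻¹ᵁ W₁).ι ≫ π₁.fiberToSpecResidueField _) ≫ t₁) (f' := a₂) (g' := j₂)
    (by simp) (by simp [τ]) (by simp [a₂]) (by simp [τ, htj₁])
  let ψ := h₁'.isoIsPullback _ _ h₂
  refine ⟨τ, j₁, ψ, hj₁, ht₁, ?_, ?_⟩
  · have : ψ.hom ≫ _ = _ := h₁'.isoIsPullback_hom_snd _ _ h₂
    rw [this, Category.assoc]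
  · have : ψ.hom ≫ _ = _ := h₁'.isoIsPullback_hom_fst _ _ h₂
    rw [← morphismRestrict_ι, reassoc_of% this]

theorem finite_of_notMem_source {X : Scheme.{u}} [IsIntegral X] [NoetherianSpace X]
    (U : X.Opens) (hU : Dense (U : Set X)) : {x : X | Order.coheight x = 1 ∧ x ∉ U}.Finite := by
  obtain ⟨S, hS, hSc, hSi, hSU⟩ := NoetherianSpace.exists_finite_set_isClosed_irreducible
    (s := (U : Set X)ᶜ) U.2.isClosed_compl
  have hη : genericPoint X ∈ U :=
    ((genericPoint_spec X).mem_open_set_iff U.2).mpr (by simpa using hU.nonempty)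
  refine (hS.biUnion (t := fun T ↦ {x : X | closure {x} = T}) fun T _ ↦ ?_).subset ?_
  · refine Set.Subsingleton.finite fun x hx y hy ↦ ?_
    exact (IsGenericPoint.eq (S := T) hx hy)
  · rintro x ⟨hx, hxU⟩
    have : x ∈ ⋃₀ S := hSU ▸ hxU
    obtain ⟨T, hT, hxT⟩ := this
    refine Set.mem_biUnion hT ?_
    obtain ⟨y, hy⟩ := QuasiSober.sober (hSi T hT) (hSc T hT)
    have hyx : y ⤳ x := hy.specializes hxT
    have hyU : y ∉ U := by
      have h1 : y ∈ ⋃₀ S := ⟨T, hT, hy.mem⟩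
      rw [← hSU] at h1
      exact h1
    have hle : x ≤ y := hyx
    by_cases hxy : y ≤ x
    · have : x = y := ((show x ⤳ y from hxy).antisymm hyx).eq
      rw [this]
      exact hy
    · exfalso
      have hlt : x < y := lt_of_le_not_ge hle hxy
      have hηy : y ≤ genericPoint X := (genericPoint_spec X).specializes trivial
      have hlt2 : y < genericPoint X := by
        refine lt_of_le_not_ge hηy fun h ↦ hyU ?_
        have : y = genericPoint X := ((show y ⤳ genericPoint X from h).antisymm hηy).eq
        rw [this]
        exact hη
      have h1 := Order.coheight_add_one_le hlt
      have h2 := Order.coheight_add_one_le hlt2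
      rw [hx] at h1
      have h3 : (1 : ℕ∞) ≤ Order.coheight y := le_trans (by simp) h2
      have h4 : (1 : ℕ∞) + 1 ≤ 1 := le_trans (by gcongr) h1
      exact absurd h4 (by decide)

theorem exists_lift_functionField {X : Scheme.{u}} [IsIntegral X] {K : Type u} [Field K]
    (g : Spec (.of K) ⟶ X) (h : ∀ p, g p = genericPoint X) :
    ∃ t : Spec (.of K) ⟶ Spec X.functionField, t ≫ X.fromSpecStalk _ = g := by
  obtain ⟨t, ht⟩ := exists_lift_residueField g _ h
  refine ⟨t ≫ Spec.map (X.residue _), ?_⟩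
  rw [Category.assoc, ← ht]
  rfl

theorem partialIso_genericPoint {X Y : Scheme.{u}} [IsIntegral X] [IsIntegral Y]
    (f : X.PartialIso Y) (hX : genericPoint X ∈ f.source) :
    (f.iso.hom ≫ f.target.ι) ⟨genericPoint X, hX⟩ = genericPoint Y := by
  have : Nonempty f.source := ⟨⟨_, hX⟩⟩
  have h : (⟨genericPoint X, hX⟩ : f.source) = genericPoint f.source := by
    apply f.source.ι.isOpenEmbedding.injective
    rw [genericPoint_eq_of_isOpenImmersion f.source.ι]
    rfl
  rw [h]
  exact genericPoint_eq_of_isOpenImmersion _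

theorem genericPoint_mem_of_dense {X : Scheme.{u}} [IsIntegral X] {U : X.Opens}
    (hU : Dense (U : Set X)) : genericPoint X ∈ U :=
  ((genericPoint_spec X).mem_open_set_iff U.2).mpr (by simpa using hU.nonempty)

theorem exists_functionField_iso_of_partialIso {X Y : Scheme.{u}} [IsIntegral X] [IsIntegral Y]
    (f : X.PartialIso Y) : ∃ (hX : genericPoint X ∈ f.source)
      (e : Spec X.functionField ≅ Spec Y.functionField),
      e.hom ≫ Y.fromSpecStalk _ = f.source.fromSpecStalkOfMem _ hX ≫ f.iso.hom ≫ f.target.ι := by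
  have hX := genericPoint_mem_of_dense f.dense_source
  have hY := genericPoint_mem_of_dense f.dense_target
  obtain ⟨t₁, ht₁⟩ := exists_lift_functionField (K := X.functionField)
    (f.source.fromSpecStalkOfMem _ hX ≫ f.iso.hom ≫ f.target.ι) fun p ↦ by
      rw [Scheme.Hom.comp_apply, fromSpecStalkOfMem_genericPoint_apply]
      exact partialIso_genericPoint f hX
  obtain ⟨t₂, ht₂⟩ := exists_lift_functionField (K := Y.functionField)
    (f.target.fromSpecStalkOfMem _ hY ≫ f.iso.inv ≫ f.source.ι) fun p ↦ by
      rw [Scheme.Hom.comp_apply, fromSpecStalkOfMem_genericPoint_apply]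
      exact partialIso_genericPoint f.symm hY
  have h₁ : t₁ ≫ f.target.fromSpecStalkOfMem _ hY = f.source.fromSpecStalkOfMem _ hX ≫ f.iso.hom := by
    rw [← cancel_mono f.target.ι, Category.assoc, Scheme.Opens.fromSpecStalkOfMem_ι,
      Category.assoc]
    exact ht₁
  have h₂ : t₂ ≫ f.source.fromSpecStalkOfMem _ hX = f.target.fromSpecStalkOfMem _ hY ≫ f.iso.inv := by
    rw [← cancel_mono f.source.ι, Category.assoc, Scheme.Opens.fromSpecStalkOfMem_ι,
      Category.assoc]
    exact ht₂
  refine ⟨hX, ⟨t₁, t₂, ?_, ?_⟩, ht₁⟩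
  · rw [← cancel_mono (X.fromSpecStalk _)]
    refine (Category.assoc _ _ _).trans ?_
    erw [ht₂]
    rw [reassoc_of% h₁]
    simp
  · rw [← cancel_mono (Y.fromSpecStalk _)]
    refine (Category.assoc _ _ _).trans ?_
    erw [ht₁]
    rw [reassoc_of% h₂]
    simp

/-! ### Varieties and birational maps -/

/-- A variety over the base `S`: an integral scheme, separated and of finite type over `S`.
This is used for `S` the spectrum of a field. -/
structure VarietyOver (S : Scheme.{u}) where
  /-- the underlying scheme -/
  X : Scheme.{u}
  /-- the structure morphism -/
  str : X ⟶ S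
  [isIntegral : IsIntegral X]
  [isSeparated : IsSeparated str]
  [locallyOfFiniteType : LocallyOfFiniteType str]
  [quasiCompact : QuasiCompact str]

attribute [instance] VarietyOver.isIntegral VarietyOver.isSeparated
  VarietyOver.locallyOfFiniteType VarietyOver.quasiCompact

/-- Varieties over a field `k`. -/
abbrev Variety (k : Type u) [Field k] := VarietyOver (Spec (.of k))

/-- The closure of a point `x` of `X`, with its reduced structure, as a variety. For a point of
codimension one this is the prime divisor with generic point `x`. -/
noncomputable def VarietyOver.subvariety {S : Scheme.{u}} (X : VarietyOver S) (x : X.X) :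
    VarietyOver S where
  X := (Scheme.IdealSheafData.vanishingIdeal (Closeds.closure {x})).subscheme
  str := (Scheme.IdealSheafData.vanishingIdeal (Closeds.closure {x})).subschemeι ≫ X.str
  isIntegral := isIntegral_vanishingIdeal_closure x

/-- The closed immersion of the closure of a point. -/
noncomputable def VarietyOver.subvarietyι {S : Scheme.{u}} (X : VarietyOver S) (x : X.X) :
    (X.subvariety x).X ⟶ X.X :=
  (Scheme.IdealSheafData.vanishingIdeal (Closeds.closure {x})).subschemeι

/-- A birational map `X ⇢ Y` over `S`, given by a representative: an isomorphism over `S` between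
dense open subschemes. All notions below depend only on the underlying rational map. -/
structure BirMap {S : Scheme.{u}} (X Y : VarietyOver S) extends X.X.PartialIso Y.X where
  isOver : toPartialIso.IsOver X.str Y.str

/-- The set `ExDiv(φ)` of exceptional divisors of a birational map `φ : X ⇢ Y`: the prime divisors
of `X` (given by their generic points, the points of codimension one) that meet no open subset of
`X` on which `φ` is an isomorphism onto an open subset of `Y`. -/
def exDiv {X Y : Scheme.{u}} (φ : X.PartialIso Y) : Set X :=
  {x | Order.coheight x = 1 ∧
    ∀ ψ : X.PartialIso Y, ψ.toRationalMap = φ.toRationalMap → x ∉ ψ.source}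

theorem exDiv_finite {X Y : Scheme.{u}} [IsIntegral X] [NoetherianSpace X] (φ : X.PartialIso Y) :
    (exDiv φ).Finite :=
  (finite_of_notMem_source φ.source φ.dense_source).subset fun _ hx ↦ ⟨hx.1, hx.2 φ rfl⟩

/-! ### The Burnside group and the motivic invariant -/

/-- Birational equivalence of `k`-varieties. -/
def birationalSetoid (k : Type u) [Field k] : Setoid (Variety k) where
  r X Y := Scheme.BirationalOver X.str Y.str
  iseqv := ⟨fun X ↦ .refl X.str, fun h ↦ h.symm, fun h₁ h₂ ↦ h₁.trans h₂⟩

/-- The Burnside group of `k`: the free abelian group on the birational isomorphism classes of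
`k`-varieties. -/
abbrev Burn (k : Type u) [Field k] := FreeAbelianGroup (Quotient (birationalSetoid k))

/-- The class of a `k`-variety in the Burnside group. -/
def Burn.cls {k : Type u} [Field k] (X : Variety k) : Burn k :=
  FreeAbelianGroup.of (Quotient.mk (birationalSetoid k) X)

/-- The motivic invariant `c(φ) = ∑_{E ∈ ExDiv(φ⁻¹)} [E] - ∑_{D ∈ ExDiv(φ)} [D]` (finite sums, see
`exDiv_finite`). -/
noncomputable def BirMap.c {k : Type u} [Field k] {X Y : Variety k} (φ : BirMap X Y) : Burn k :=
  (∑ᶠ y ∈ exDiv φ.toPartialIso.symm, Burn.cls (Y.subvariety y)) -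
    ∑ᶠ x ∈ exDiv φ.toPartialIso, Burn.cls (X.subvariety x)

/-! ### Relative birational types -/

/-- An object `X/F`: a finitely generated field extension `F` of `k` (given by the morphism
`Spec F ⟶ Spec k`) and a variety `X` over `F`. -/
structure RelVariety (k : Type u) [Field k] where
  /-- the field `F` -/
  F : CommRingCat.{u}
  isField : IsField F
  /-- the morphism `Spec F ⟶ Spec k` -/
  base : Spec F ⟶ Spec (.of k)
  /-- `F` is finitely generated as a field extension of `k` -/
  essFiniteType : (Spec.preimage base).hom.EssFiniteType
  /-- the variety over `F` -/
  toVariety : VarietyOver (Spec F)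

/-- A morphism `X₁/F₁ ⇢ X₂/F₂`: an isomorphism `Spec F₁ ≅ Spec F₂` over `k` and a birational map
`X₁ ⇢ X₂` over it. -/
structure RelBirMap {k : Type u} [Field k] (X₁ X₂ : RelVariety k) where
  /-- the isomorphism of the base fields -/
  baseIso : Spec X₁.F ≅ Spec X₂.F
  baseIso_over : baseIso.hom ≫ X₂.base = X₁.base
  /-- the birational map -/
  map : X₁.toVariety.X.PartialIso X₂.toVariety.X
  isOver : map.IsOver (X₁.toVariety.str ≫ baseIso.hom) X₂.toVariety.str

/-- Isomorphism of objects `X/F`. -/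
def relBirationalSetoid (k : Type u) [Field k] : Setoid (RelVariety k) where
  r X₁ X₂ := Nonempty (RelBirMap X₁ X₂)
  iseqv := by
    refine ⟨fun X ↦ ⟨⟨Iso.refl _, by simp, .refl _, ?_⟩⟩, ?_, ?_⟩
    · simp only [Scheme.PartialIso.IsOver, Iso.refl_hom, Category.comp_id]
      exact Category.id_comp _
    · rintro X₁ X₂ ⟨τ, hτ, f, hf⟩
      refine ⟨⟨τ.symm, by simp [← hτ], f.symm, ?_⟩⟩
      have h := hf.symm
      have h' : f.iso.inv ≫ f.source.ι ≫ X₁.toVariety.str ≫ τ.hom =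
        f.target.ι ≫ X₂.toVariety.str := h
      have h'' := congrArg (· ≫ τ.inv) h'
      simp only [Category.assoc, Iso.hom_inv_id, Category.comp_id] at h''
      exact h''
    · rintro X₁ X₂ X₃ ⟨τ, hτ, f, hf⟩ ⟨ρ, hρ, g, hg⟩
      refine ⟨⟨τ ≪≫ ρ, by simp [hτ, hρ], f.trans g, ?_⟩⟩
      have h : f.IsOver (X₁.toVariety.str ≫ τ.hom ≫ ρ.hom) (X₂.toVariety.str ≫ ρ.hom) := by
        have h'' := congrArg (· ≫ ρ.hom) hf
        simpa only [Category.assoc] using h''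
      exact h.trans hg

/-- The big Burnside group of `k`: the free abelian group on the isomorphism classes of
objects `X/F`. -/
abbrev BigBurn (k : Type u) [Field k] := FreeAbelianGroup (Quotient (relBirationalSetoid k))

/-- The class `[X/F]` in the big Burnside group. -/
def BigBurn.cls {k : Type u} [Field k] (X : RelVariety k) : BigBurn k :=
  FreeAbelianGroup.of (Quotient.mk (relBirationalSetoid k) X)

/-- The object `E/F`, for `E` the closure of a point of `X`. -/
noncomputable def RelVariety.subvariety {k : Type u} [Field k] (X : RelVariety k)
    (x : X.toVariety.X) : RelVariety k :=
  { X with toVariety := X.toVariety.subvariety x }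

/-- The motivic invariant
`c(φ) = ∑_{E ∈ ExDiv(φ⁻¹)} [E/F₂] - ∑_{D ∈ ExDiv(φ)} [D/F₁]` of `φ : X₁/F₁ ⇢ X₂/F₂`. -/
noncomputable def RelBirMap.c {k : Type u} [Field k] {X₁ X₂ : RelVariety k}
    (φ : RelBirMap X₁ X₂) : BigBurn k :=
  (∑ᶠ y ∈ exDiv φ.map.symm, BigBurn.cls (X₂.subvariety y)) -
    ∑ᶠ x ∈ exDiv φ.map, BigBurn.cls (X₁.subvariety x)

/-- `Y` is a `k`-variety whose function field is isomorphic, over `k`, to the function field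
`F(X)` of `X/F`. -/
def IsModel {k : Type u} [Field k] (Y : Variety k) (X : RelVariety k) : Prop :=
  ∃ e : Spec Y.X.functionField ≅ Spec X.toVariety.X.functionField,
    e.hom ≫ X.toVariety.X.fromSpecStalk _ ≫ X.toVariety.str ≫ X.base =
      Y.X.fromSpecStalk _ ≫ Y.str

theorem exists_isModel {k : Type u} [Field k] (X : RelVariety k) : ∃ Y : Variety k, IsModel Y X := by
  have h : (Spec.preimage (X.toVariety.X.fromSpecStalk (genericPoint X.toVariety.X) ≫
      X.toVariety.str ≫ X.base)).hom.EssFiniteType := by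
    have h1 : Spec.preimage (X.toVariety.X.fromSpecStalk (genericPoint X.toVariety.X) ≫
        X.toVariety.str ≫ X.base) = Spec.preimage X.base ≫ Spec.preimage
          (X.toVariety.X.fromSpecStalk (genericPoint X.toVariety.X) ≫ X.toVariety.str) := by
      apply Spec.map_injective
      simp
    rw [h1, CommRingCat.hom_comp]
    exact X.essFiniteType.comp (essFiniteType_of_locallyOfFiniteType _ _)
  obtain ⟨Y, s, h1, h2, h3, h4, e, he⟩ := exists_model (K := X.toVariety.X.functionField) _ _ h
  refine ⟨⟨Y, s⟩, e, ?_⟩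
  rw [← he]
  simp

theorem IsModel.birationalOver {k : Type u} [Field k] {X₁ X₂ : RelVariety k}
    (φ : RelBirMap X₁ X₂) {Y₁ Y₂ : Variety k} (h₁ : IsModel Y₁ X₁) (h₂ : IsModel Y₂ X₂) :
    Scheme.BirationalOver Y₁.str Y₂.str := by
  obtain ⟨e₁, he₁⟩ := h₁
  obtain ⟨e₂, he₂⟩ := h₂
  obtain ⟨hX, e, he⟩ := exists_functionField_iso_of_partialIso φ.map
  refine birationalOver_of_functionField _ _ (e₁ ≪≫ e ≪≫ e₂.symm) ?_
  have hφ : φ.map.iso.hom ≫ φ.map.target.ι ≫ X₂.toVariety.str =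
    φ.map.source.ι ≫ X₁.toVariety.str ≫ φ.baseIso.hom := φ.isOver
  simp only [Iso.trans_hom, Iso.symm_hom, Category.assoc]
  rw [← he₂, e₂.inv_hom_id_assoc, reassoc_of% he, reassoc_of% hφ, φ.baseIso_over, ← he₁,
    Scheme.Opens.fromSpecStalkOfMem_ι_assoc]

/-- On birational classes, `X/F` is sent to the class of the `k`-varieties with function field
`F(X)`. -/
noncomputable def forgetClass {k : Type u} [Field k] :
    Quotient (relBirationalSetoid k) → Quotient (birationalSetoid k) :=
  Quotient.lift (fun X ↦ Quotient.mk (birationalSetoid k) (exists_isModel X).choose)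
    fun X₁ X₂ ⟨φ⟩ ↦ Quotient.sound (s := birationalSetoid k)
      (IsModel.birationalOver φ (exists_isModel X₁).choose_spec (exists_isModel X₂).choose_spec)

/-- The forgetful homomorphism `[X/F] ↦ [F(X)/k]`. -/
noncomputable def BigBurn.forget {k : Type u} [Field k] : BigBurn k →+ Burn k :=
  FreeAbelianGroup.map forgetClass

/-! ### Dominant morphisms, generic fibres, horizontal and vertical invariants -/

/-- A dominant morphism of varieties over `S`. -/
structure DominantHom {S : Scheme.{u}} (X B : VarietyOver S) where
  /-- the underlying morphism -/
  hom : X.X ⟶ B.X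
  comp_str : hom ≫ B.str = X.str
  [isDominant : IsDominant hom]

attribute [instance] DominantHom.isDominant

/-- The generic fibre `X_η / k(B)` of a dominant morphism `π : X ⟶ B`. -/
noncomputable def DominantHom.genericFiber {k : Type u} [Field k] {X B : Variety k}
    (π : DominantHom X B) : RelVariety k where
  F := B.X.residueField (genericPoint B.X)
  isField := Field.toIsField _
  base := B.X.fromSpecResidueField (genericPoint B.X) ≫ B.str
  essFiniteType := essFiniteType_residueField B.str _
  toVariety :=
    { X := π.hom.fiber (genericPoint B.X)
      str := π.hom.fiberToSpecResidueField (genericPoint B.X)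
      isIntegral := isIntegral_fiber_genericPoint π.hom
      isSeparated := by
        have : IsSeparated (π.hom ≫ B.str) := by rw [π.comp_str]; infer_instance
        have : IsSeparated π.hom := IsSeparated.of_comp π.hom B.str
        exact inferInstanceAs (IsSeparated (pullback.snd _ _))
      locallyOfFiniteType := by
        have : LocallyOfFiniteType (π.hom ≫ B.str) := by rw [π.comp_str]; infer_instance
        have : LocallyOfFiniteType π.hom := locallyOfFiniteType_of_comp π.hom B.str
        exact inferInstanceAs (LocallyOfFiniteType (pullback.snd _ _))
      quasiCompact := by
        have : QuasiCompact (π.hom ≫ B.str) := by rw [π.comp_str]; infer_instance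
        have : QuasiCompact π.hom := QuasiCompact.of_comp π.hom B.str
        exact inferInstanceAs (QuasiCompact (pullback.snd _ _)) }

/-- An element of `Bir(π₁, π₂)`: birational maps `total : X₁ ⇢ X₂` and `base : B₁ ⇢ B₂` such that
the rational maps `π₂ ∘ total` and `base ∘ π₁` coincide, that is, agree on a dense open subset
of `X₁` on which both are defined. (`base` is determined by `total` as a rational map.) -/
structure SquareBirMap {k : Type u} [Field k] {X₁ X₂ B₁ B₂ : Variety k}
    (π₁ : DominantHom X₁ B₁) (π₂ : DominantHom X₂ B₂) where
  /-- the birational map of total spaces -/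
  total : BirMap X₁ X₂
  /-- the birational map of bases -/
  base : BirMap B₁ B₂
  comm : ∃ (U : X₁.X.Opens) (_ : Dense (U : Set X₁.X)) (h₁ : U ≤ total.source)
    (h₂ : U ≤ π₁.hom ⁻¹ᵁ base.source),
    X₁.X.homOfLE h₁ ≫ total.iso.hom ≫ total.target.ι ≫ π₂.hom =
      π₁.hom.resLE base.source U h₂ ≫ base.iso.hom ≫ base.target.ι

theorem exists_restrictSource {X Y : Scheme.{u}} (φ : X.PartialIso Y) (U : X.Opens)
    (hU : Dense (U : Set X)) (h : U ≤ φ.source) :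
    ∃ (W : Y.Opens) (_ : Dense (W : Set Y)) (e : U.toScheme ≅ W.toScheme),
      e.hom ≫ W.ι = X.homOfLE h ≫ φ.iso.hom ≫ φ.target.ι := by
  refine ⟨_, (φ.restrictSource U hU h).dense_target, (φ.restrictSource U hU h).iso, ?_⟩
  have h1 : (Scheme.Opens.isoOfLE h).inv ≫ (φ.source.ι ⁻¹ᵁ U).ι = X.homOfLE h := by
    rw [← cancel_mono φ.source.ι]
    simp
  simp [Scheme.PartialIso.restrictSource, reassoc_of% h1]

/-- `ψ` is the birational map induced by `φ` on the generic fibres: where `ψ` is defined, it is the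
restriction of `φ`. -/
def IsGenericRestriction {k : Type u} [Field k] {X₁ X₂ B₁ B₂ : Variety k}
    {π₁ : DominantHom X₁ B₁} {π₂ : DominantHom X₂ B₂} (φ : SquareBirMap π₁ π₂)
    (ψ : RelBirMap π₁.genericFiber π₂.genericFiber) : Prop :=
  ∃ h : ψ.map.source ≤ π₁.hom.fiberι (genericPoint B₁.X) ⁻¹ᵁ φ.total.source,
    ψ.map.iso.hom ≫ ψ.map.target.ι ≫ π₂.hom.fiberι (genericPoint B₂.X) =
      (π₁.hom.fiberι (genericPoint B₁.X)).resLE φ.total.source ψ.map.source h ≫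
        φ.total.iso.hom ≫ φ.total.target.ι

theorem exists_isGenericRestriction {k : Type u} [Field k] {X₁ X₂ B₁ B₂ : Variety k}
    {π₁ : DominantHom X₁ B₁} {π₂ : DominantHom X₂ B₂} (φ : SquareBirMap π₁ π₂) :
    ∃ ψ : RelBirMap π₁.genericFiber π₂.genericFiber, IsGenericRestriction φ ψ := by
  obtain ⟨U, hU, h₁, h₂, hcomm⟩ := φ.comm
  obtain ⟨W, hW, e, hf⟩ := exists_restrictSource φ.total.toPartialIso U hU h₁
  have hσ := genericPoint_mem_of_dense φ.base.dense_source
  obtain ⟨τ, j, ψ, hj, hτ, hψ₁, hψ₂⟩ := exists_fiber_iso π₁.hom π₂.hom U W φ.base.source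
    φ.base.target hσ (genericPoint_mem_of_dense φ.base.dense_target) e φ.base.iso
    (π₁.hom.resLE φ.base.source U h₂) (by simp) (by rw [← hcomm, reassoc_of% hf])
  have hdense : ∀ {X B : Variety k} (π : DominantHom X B) (W : X.X.Opens),
      Dense (W : Set X.X) → Dense ((π.hom.fiberι (genericPoint B.X) ⁻¹ᵁ W : Scheme.Opens _) :
        Set (π.hom.fiber (genericPoint B.X))) := by
    intro X B π W hW
    have := isIntegral_fiber_genericPoint π.hom
    refine (π.hom.fiberι (genericPoint B.X) ⁻¹ᵁ W).2.dense ?_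
    have hg : genericPoint X.X ∈ Set.range (π.hom.fiberι (genericPoint B.X)) := by
      rw [π.hom.range_fiberι]
      exact apply_genericPoint_of_isDominant π.hom
    obtain ⟨g, hg⟩ := hg
    refine ⟨g, ?_⟩
    change π.hom.fiberι (genericPoint B.X) g ∈ W
    rw [hg]
    exact genericPoint_mem_of_dense hW
  refine ⟨⟨τ, ?_, ⟨_, hdense π₁ U hU, _, hdense π₂ W hW, ψ⟩, ?_⟩, ?_⟩
  · change τ.hom ≫ B₂.X.fromSpecResidueField _ ≫ B₂.str = B₁.X.fromSpecResidueField _ ≫ B₁.str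
    have h : φ.base.iso.hom ≫ φ.base.target.ι ≫ B₂.str = φ.base.source.ι ≫ B₁.str := φ.base.isOver
    rw [reassoc_of% hτ, h, reassoc_of% hj]
  · exact hψ₁
  · refine ⟨(π₁.hom.fiberι (genericPoint B₁.X)).preimage_mono h₁, ?_⟩
    refine hψ₂.trans ?_
    have h3 : (π₁.hom.fiberι (genericPoint B₁.X) ∣_ U) ≫ X₁.X.homOfLE h₁ =
        (π₁.hom.fiberι (genericPoint B₁.X)).resLE φ.total.source _
          ((π₁.hom.fiberι (genericPoint B₁.X)).preimage_mono h₁) := by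
      rw [← cancel_mono φ.total.source.ι]
      simp
    rw [hf, reassoc_of% h3]

/-- The birational map `φ^η` induced by `φ` on the generic fibres. -/
noncomputable def SquareBirMap.genericFiber {k : Type u} [Field k] {X₁ X₂ B₁ B₂ : Variety k}
    {π₁ : DominantHom X₁ B₁} {π₂ : DominantHom X₂ B₂} (φ : SquareBirMap π₁ π₂) :
    RelBirMap π₁.genericFiber π₂.genericFiber :=
  (exists_isGenericRestriction φ).choose

/-- The horizontal motivic invariant: the image of `c(φ^η)` in the Burnside group. -/
noncomputable def SquareBirMap.cHor {k : Type u} [Field k] {X₁ X₂ B₁ B₂ : Variety k}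
    {π₁ : DominantHom X₁ B₁} {π₂ : DominantHom X₂ B₂} (φ : SquareBirMap π₁ π₂) : Burn k :=
  BigBurn.forget φ.genericFiber.c

/-- The vertical motivic invariant. -/
noncomputable def SquareBirMap.cVer {k : Type u} [Field k] {X₁ X₂ B₁ B₂ : Variety k}
    {π₁ : DominantHom X₁ B₁} {π₂ : DominantHom X₂ B₂} (φ : SquareBirMap π₁ π₂) : Burn k :=
  φ.total.c - φ.cHor

/-! ### Birational triviality in codimension one -/

/-- A normal scheme. -/
def IsNormalScheme (X : Scheme.{u}) : Prop :=
  ∀ x : X, IsIntegrallyClosed (X.presheaf.stalk x)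

/-- The closed immersion of the reduction of `X`. -/
noncomputable abbrev redι (X : Scheme.{u}) : X.nilradical.subscheme ⟶ X :=
  X.nilradical.subschemeι

/-- For the prime divisor `D` of `B` with generic point `ζ`, the preimage `π⁻¹(D)` is irreducible
and birational to `D × F` over `D` (both with their reduced structure). -/
def IsBirationallyTrivialAt {k : Type u} [Field k] {X B : Variety k} (π : DominantHom X B)
    (F : Variety k) (ζ : B.X) : Prop :=
  IsIrreducible (π.hom ⁻¹' closure {ζ}) ∧
    Scheme.BirationalOver
      (redι (pullback π.hom (B.subvarietyι ζ)) ≫ pullback.snd π.hom (B.subvarietyι ζ))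
      (redι (pullback (B.subvariety ζ).str F.str) ≫ pullback.fst (B.subvariety ζ).str F.str)

/-- `π : X ⟶ B` is birationally trivial in codimension one with fibre `F`: it is a flat morphism of
normal varieties and, for all but finitely many prime divisors `D` of `B`, the preimage `π⁻¹(D)` is
irreducible and birational to `D × F` over `D`. -/
structure IsBirationallyTrivialInCodimOne {k : Type u} [Field k] {X B : Variety k}
    (π : DominantHom X B) (F : Variety k) : Prop where
  flat : Flat π.hom
  normal_source : IsNormalScheme X.X
  normal_target : IsNormalScheme B.X
  finite : {ζ : B.X | Order.coheight ζ = 1 ∧ ¬ IsBirationallyTrivialAt π F ζ}.Finite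

end MotivicBir

/-! The invariant `c(φ)` is an index. On points of codimension one `φ` induces a partial bijection
with cofinite domain and range that preserves residue fields over `k`, and `c(φ)` is the sum of the
classes missing from the range minus the sum of those missing from the domain. Removing finitely
many pairs from the graph does not change the index, since both ends of a pair have the same class
(`IsCofiniteGraph.graphIndex_eq`). Hence any cofinite subgraph computes it.

The points of codimension one of `X` are horizontal or vertical. The horizontal ones are the points
of codimension one of the generic fibre, and their part of the index is `c_hor(φ)`; so `c_ver(φ)` is
the index on vertical points (`SquareBirMap.cVer_eq_graphIndex`).

By flatness a vertical point lies over a point of codimension one of `B`. Birational triviality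
makes `x ↦ π x` a bijection between cofinite sets of vertical points of `X` and of codimension-one
points of `B`, compatible with `φ` and the base map `σ`. The closure of `x` has the birational class
of `D × F`, with `D` the closure of `π x`, and this depends only on the class of `D`. So one
homomorphism of Burnside groups sends `c(σ)` to `c_ver(φ)`
(`IsBirationallyTrivialInCodimOne.cVer_eq`), and `c(σ) = 0` gives the result. -/

namespace MotivicBir

/-! ### The index of a partial bijection -/

section Index

variable {α β α' β' M N L : Type*} [AddCommGroup M] [AddCommGroup N] [AddCommGroup L]

/-- The index `∑_{V' \ pr₂ G} c' - ∑_{V \ pr₁ G} c` of a partial bijection `V ⇀ V'`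
with graph `G`. -/
noncomputable def graphIndex (V : Set α) (V' : Set β) (c : α → M) (c' : β → M)
    (G : Set (α × β)) : M :=
  (∑ᶠ y ∈ V' \ Prod.snd '' G, c' y) - ∑ᶠ x ∈ V \ Prod.fst '' G, c x

/-- `G` is the graph of a partial bijection from `V` to `V'` with cofinite domain and range. -/
structure IsCofiniteGraph (V : Set α) (V' : Set β) (G : Set (α × β)) : Prop where
  fst_mem : ∀ g ∈ G, g.1 ∈ V
  snd_mem : ∀ g ∈ G, g.2 ∈ V'
  fst_inj : Set.InjOn Prod.fst G
  snd_inj : Set.InjOn Prod.snd G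
  finite_fst : (V \ Prod.fst '' G).Finite
  finite_snd : (V' \ Prod.snd '' G).Finite

/-- Shrinking `G` enlarges the complement of the image by exactly `f '' (G \ G₀)`. The map `f`
stands for either projection. Finiteness matters: a `finsum` with infinite support is zero by
convention. -/
theorem finsum_mem_diff_image_of_subset {ι : Type*} {V : Set α} {c : α → M} {f : ι → α}
    {G G₀ : Set ι} (hf : ∀ g ∈ G, f g ∈ V) (hinj : Set.InjOn f G) (h : G₀ ⊆ G)
    (hfin : (V \ f '' G₀).Finite) :
    ∑ᶠ x ∈ V \ f '' G₀, c x = ∑ᶠ x ∈ V \ f '' G, c x + ∑ᶠ g ∈ G \ G₀, c (f g) := by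
  have hset : V \ f '' G₀ = (V \ f '' G) ∪ f '' (G \ G₀) := by
    rw [hinj.image_sdiff_subset h]
    ext x
    constructor
    · rintro ⟨hx, hx'⟩
      by_cases hG : x ∈ f '' G
      · exact Or.inr ⟨hG, hx'⟩
      · exact Or.inl ⟨hx, hG⟩
    · rintro (⟨hx, hx'⟩ | ⟨⟨g, hg, rfl⟩, hx'⟩)
      · exact ⟨hx, fun H ↦ hx' (Set.image_mono h H)⟩
      · exact ⟨hf g hg, hx'⟩
  have hfin' := hfin
  rw [hset] at hfin'
  rw [hset, finsum_mem_union _ (hfin'.subset Set.subset_union_left)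
    (hfin'.subset Set.subset_union_right), finsum_mem_image (hinj.mono Set.sdiff_subset)]
  rw [Set.disjoint_left]
  rintro x ⟨-, hx⟩ ⟨g, hg, rfl⟩
  exact hx ⟨g, hg.1, rfl⟩

/-- A deleted pair `g` adds `c' g.2` to the first sum and `c g.1` to the second, and these cancel.
-/
theorem IsCofiniteGraph.graphIndex_eq {V : Set α} {V' : Set β} {G G₀ : Set (α × β)}
    (hG : IsCofiniteGraph V V' G) (hG₀ : IsCofiniteGraph V V' G₀) (h : G₀ ⊆ G)
    {c : α → M} {c' : β → M} (hc : ∀ g ∈ G, c' g.2 = c g.1) :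
    graphIndex V V' c c' G₀ = graphIndex V V' c c' G := by
  unfold graphIndex
  rw [finsum_mem_diff_image_of_subset hG.fst_mem hG.fst_inj h hG₀.finite_fst,
    finsum_mem_diff_image_of_subset hG.snd_mem hG.snd_inj h hG₀.finite_snd,
    finsum_mem_congr rfl fun g hg ↦ hc g hg.1]
  abel

/-- By `h` the graph never mixes `H` with its complement, so both missing sets split accordingly. -/
theorem graphIndex_add_compl {V H : Set α} {V' H' : Set β} {G : Set (α × β)}
    (hG : IsCofiniteGraph V V' G) (hH : H ⊆ V) (hH' : H' ⊆ V') 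
    (h : ∀ g ∈ G, g.1 ∈ H ↔ g.2 ∈ H') (c : α → M) (c' : β → M) :
    graphIndex V V' c c' G = graphIndex H H' c c' {g ∈ G | g.1 ∈ H} +
      graphIndex (V \ H) (V' \ H') c c' {g ∈ G | g.1 ∉ H} := by
  have h1 : V \ Prod.fst '' G = (H \ Prod.fst '' {g ∈ G | g.1 ∈ H}) ∪
      ((V \ H) \ Prod.fst '' {g ∈ G | g.1 ∉ H}) := by
    ext x
    by_cases hx : x ∈ H
    · simp [hx, hH hx]
    · simp [hx]
  have h2 : V' \ Prod.snd '' G = (H' \ Prod.snd '' {g ∈ G | g.1 ∈ H}) ∪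
      ((V' \ H') \ Prod.snd '' {g ∈ G | g.1 ∉ H}) := by
    ext y
    by_cases hy : y ∈ H'
    · simp only [Set.mem_sdiff, hH' hy, Set.mem_image, Prod.exists, exists_eq_right, true_and,
        Set.mem_ofPred_eq, Set.mem_union, hy, not_true_eq_false, and_false, false_and, or_false]
      exact not_congr ⟨fun ⟨a, ha⟩ ↦ ⟨a, ha, (h _ ha).2 hy⟩, fun ⟨a, ha⟩ ↦ ⟨a, ha.1⟩⟩
    · simp only [Set.mem_sdiff, Set.mem_image, Prod.exists, exists_eq_right,
        Set.mem_ofPred_eq, Set.mem_union, hy, not_false_eq_true, and_true, false_and, false_or]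
      exact and_congr_right fun _ ↦ not_congr
        ⟨fun ⟨a, ha⟩ ↦ ⟨a, ha, fun H ↦ hy ((h _ ha).1 H)⟩, fun ⟨a, ha⟩ ↦ ⟨a, ha.1⟩⟩
  have hf1 := hG.finite_fst
  have hf2 := hG.finite_snd
  unfold graphIndex
  rw [h1] at hf1 ⊢
  rw [h2] at hf2 ⊢
  rw [finsum_mem_union _ (hf1.subset Set.subset_union_left) (hf1.subset Set.subset_union_right),
    finsum_mem_union _ (hf2.subset Set.subset_union_left) (hf2.subset Set.subset_union_right)]
  · abel
  · exact Set.disjoint_left.2 fun x hx hx' ↦ hx'.1.2 hx.1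
  · exact Set.disjoint_left.2 fun x hx hx' ↦ hx'.1.2 hx.1

/-- The index only depends on the complement of a common subset of `V ∖ pr₁ G` and
`V ∖ pr₂ G`. -/
theorem graphIndex_eq_of_subset {V V₀ : Set α} {G : Set (α × α)} (hV : V₀ ⊆ V)
    (h1 : ∀ g ∈ G, g.1 ∈ V₀) (h2 : ∀ g ∈ G, g.2 ∈ V₀) (hf1 : (V \ Prod.fst '' G).Finite)
    (hf2 : (V \ Prod.snd '' G).Finite) (c : α → M) :
    graphIndex V V c c G = graphIndex V₀ V₀ c c G := by
  -- Neither projection meets `V \ V₀`, so both sums contain the same contribution from this set; it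
  -- cancels because source and target are the same set with the same function `c`.
  have key : ∀ p : α × α → α, (∀ g ∈ G, p g ∈ V₀) → (V \ p '' G).Finite →
      ∑ᶠ x ∈ V \ p '' G, c x = ∑ᶠ x ∈ V \ V₀, c x + ∑ᶠ x ∈ V₀ \ p '' G, c x := by
    intro p hp hf
    have hset : V \ p '' G = (V \ V₀) ∪ (V₀ \ p '' G) := by
      ext x
      by_cases hx : x ∈ V₀
      · simp [hx, hV hx]
      · have : x ∉ p '' G := by
          rintro ⟨g, hg, rfl⟩
          exact hx (hp g hg)
        simp only [Set.mem_sdiff, Set.mem_union, this, hx]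
        tauto
    have hf' := hf
    rw [hset] at hf' ⊢
    rw [finsum_mem_union _ (hf'.subset Set.subset_union_left)
      (hf'.subset Set.subset_union_right)]
    exact Set.disjoint_left.2 fun x hx hx' ↦ hx.2 hx'.1
  unfold graphIndex
  rw [key _ h1 hf1, key _ h2 hf2]
  abel

/-- Injectivity of `a` and `b` makes the complement of the image the image of the complement. The
two homomorphisms into a common group `L` allow classes on `X` to be compared with transported
classes on `B`. -/
theorem map_graphIndex_image {V : Set α} {V' : Set β} {G : Set (α × β)}
    (hG : IsCofiniteGraph V V' G) {a : α → α'} {b : β → β'} (ha : Set.InjOn a V)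
    (hb : Set.InjOn b V') {c : α → M} {c' : β → M} {d : α' → N} {d' : β' → N}
    (f : M →+ L) (g : N →+ L) (h : ∀ x ∈ V, f (c x) = g (d (a x)))
    (h' : ∀ y ∈ V', f (c' y) = g (d' (b y))) :
    f (graphIndex V V' c c' G) = g (graphIndex (a '' V) (b '' V') d d' (Prod.map a b '' G)) := by
  have h1 : a '' V \ Prod.fst '' (Prod.map a b '' G) = a '' (V \ Prod.fst '' G) := by
    rw [ha.image_sdiff_subset (by rintro _ ⟨g, hg, rfl⟩; exact hG.fst_mem g hg)]
    simp only [Set.image_image, Prod.map_fst]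
  have h2 : b '' V' \ Prod.snd '' (Prod.map a b '' G) = b '' (V' \ Prod.snd '' G) := by
    rw [hb.image_sdiff_subset (by rintro _ ⟨g, hg, rfl⟩; exact hG.snd_mem g hg)]
    simp only [Set.image_image, Prod.map_snd]
  unfold graphIndex
  rw [h1, h2, finsum_mem_image (ha.mono Set.sdiff_subset), finsum_mem_image (hb.mono Set.sdiff_subset),
    map_sub, map_sub, f.map_finsum_mem _ hG.finite_fst, f.map_finsum_mem _ hG.finite_snd,
    g.map_finsum_mem _ hG.finite_fst, g.map_finsum_mem _ hG.finite_snd,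
    finsum_mem_congr rfl fun x hx ↦ h x hx.1, finsum_mem_congr rfl fun x hx ↦ h' x hx.1]

theorem IsCofiniteGraph.image {V : Set α} {V' : Set β} {G : Set (α × β)}
    (hG : IsCofiniteGraph V V' G) {a : α → α'} {b : β → β'} (ha : Set.InjOn a V)
    (hb : Set.InjOn b V') : IsCofiniteGraph (a '' V) (b '' V') (Prod.map a b '' G) where
  fst_mem := by
    rintro _ ⟨g, hg, rfl⟩
    exact ⟨_, hG.fst_mem g hg, rfl⟩
  snd_mem := by
    rintro _ ⟨g, hg, rfl⟩
    exact ⟨_, hG.snd_mem g hg, rfl⟩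
  fst_inj := by
    rintro _ ⟨g, hg, rfl⟩ _ ⟨g', hg', rfl⟩ e
    rw [hG.fst_inj hg hg' (ha (hG.fst_mem g hg) (hG.fst_mem g' hg') e)]
  snd_inj := by
    rintro _ ⟨g, hg, rfl⟩ _ ⟨g', hg', rfl⟩ e
    rw [hG.snd_inj hg hg' (hb (hG.snd_mem g hg) (hG.snd_mem g' hg') e)]
  finite_fst := by
    refine (hG.finite_fst.image a).subset ?_
    rintro _ ⟨⟨x, hx, rfl⟩, hx'⟩
    refine ⟨x, ⟨hx, ?_⟩, rfl⟩
    rintro ⟨g, hg, rfl⟩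
    exact hx' ⟨_, ⟨g, hg, rfl⟩, rfl⟩
  finite_snd := by
    refine (hG.finite_snd.image b).subset ?_
    rintro _ ⟨⟨x, hx, rfl⟩, hx'⟩
    refine ⟨x, ⟨hx, ?_⟩, rfl⟩
    rintro ⟨g, hg, rfl⟩
    exact hx' ⟨_, ⟨g, hg, rfl⟩, rfl⟩

/-- Restriction of the graph of a partial bijection to cofinite subsets. -/
theorem IsCofiniteGraph.restrict {V : Set α} {V' : Set β} {G : Set (α × β)}
    (hG : IsCofiniteGraph V V' G) {A : Set α} {A' : Set β} (hA : (V \ A).Finite)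
    (hA' : (V' \ A').Finite) : IsCofiniteGraph V V' {g ∈ G | g.1 ∈ A ∧ g.2 ∈ A'} where
  fst_mem g hg := hG.fst_mem g hg.1
  snd_mem g hg := hG.snd_mem g hg.1
  fst_inj := hG.fst_inj.mono fun _ h ↦ h.1
  snd_inj := hG.snd_inj.mono fun _ h ↦ h.1
  finite_fst := by
    -- A point leaves the domain because it lies outside `A` or because its partner lies outside
    -- `A'`; the second kind is finite since a pair of `G` is determined by either of its ends.
    have : {g ∈ G | g.2 ∈ V' \ A'}.Finite :=
      Set.Finite.of_finite_image (hA'.subset (by rintro _ ⟨g, hg, rfl⟩; exact hg.2))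
        (hG.snd_inj.mono fun _ h ↦ h.1)
    refine ((hG.finite_fst.union hA).union (this.image Prod.fst)).subset ?_
    rintro x ⟨hx, hx'⟩
    by_cases h1 : x ∈ Prod.fst '' G
    · obtain ⟨g, hg, rfl⟩ := h1
      by_cases h2 : g.1 ∈ A
      · exact Or.inr ⟨g, ⟨hg, hG.snd_mem g hg, fun h ↦ hx' ⟨g, ⟨hg, h2, h⟩, rfl⟩⟩, rfl⟩
      · exact Or.inl (Or.inr ⟨hx, h2⟩)
    · exact Or.inl (Or.inl ⟨hx, h1⟩)
  finite_snd := by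
    have : {g ∈ G | g.1 ∈ V \ A}.Finite :=
      Set.Finite.of_finite_image (hA.subset (by rintro _ ⟨g, hg, rfl⟩; exact hg.2))
        (hG.fst_inj.mono fun _ h ↦ h.1)
    refine ((hG.finite_snd.union hA').union (this.image Prod.snd)).subset ?_
    rintro y ⟨hy, hy'⟩
    by_cases h1 : y ∈ Prod.snd '' G
    · obtain ⟨g, hg, rfl⟩ := h1
      by_cases h2 : g.2 ∈ A'
      · exact Or.inr ⟨g, ⟨hg, hG.fst_mem g hg, fun h ↦ hy' ⟨g, ⟨hg, h, h2⟩, rfl⟩⟩, rfl⟩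
      · exact Or.inl (Or.inr ⟨hy, h2⟩)
    · exact Or.inl (Or.inl ⟨hy, h1⟩)

end Index

/-! ### Points with the same residue field -/

/-- The points `x` and `y` have isomorphic residue fields over `S`. -/
def SameResidueField {S X Y : Scheme.{u}} (sX : X ⟶ S) (sY : Y ⟶ S) (x : X) (y : Y) : Prop :=
  ∃ e : Spec (X.residueField x) ≅ Spec (Y.residueField y),
    e.hom ≫ Y.fromSpecResidueField y ≫ sY = X.fromSpecResidueField x ≫ sX

section SameResidueField

variable {S X Y Z : Scheme.{u}} {sX : X ⟶ S} {sY : Y ⟶ S} {sZ : Z ⟶ S} {x : X} {y : Y} {z : Z}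

theorem SameResidueField.refl (sX : X ⟶ S) (x : X) : SameResidueField sX sX x x :=
  ⟨Iso.refl _, by simp⟩

theorem SameResidueField.symm (h : SameResidueField sX sY x y) : SameResidueField sY sX y x := by
  obtain ⟨e, he⟩ := h
  exact ⟨e.symm, by simp [← he]⟩

theorem SameResidueField.trans (h : SameResidueField sX sY x y) (h' : SameResidueField sY sZ y z) :
    SameResidueField sX sZ x z := by
  obtain ⟨e, he⟩ := h
  obtain ⟨e', he'⟩ := h'
  exact ⟨e ≪≫ e', by simp [he, he']⟩

theorem SameResidueField.comp (h : SameResidueField sX sY x y) {T : Scheme.{u}} (f : S ⟶ T) :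
    SameResidueField (sX ≫ f) (sY ≫ f) x y := by
  obtain ⟨e, he⟩ := h
  exact ⟨e, by rw [reassoc_of% he]⟩

/-- Stalk maps of a preimmersion are surjective, hence so are the residue field maps, and
homomorphisms of fields are injective. -/
theorem isIso_residueFieldMap (i : X ⟶ Y) [IsPreimmersion i] (x : X) :
    IsIso (i.residueFieldMap x) := by
  have hs : Function.Surjective (i.residueFieldMap x).hom := by
    have h : Function.Surjective (Y.residue (i x) ≫ i.residueFieldMap x).hom := by
      rw [Scheme.residue_residueFieldMap, CommRingCat.hom_comp]
      exact (X.residue_surjective x).comp (i.stalkMap_surjective x)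
    rw [CommRingCat.hom_comp, RingHom.coe_comp] at h
    exact h.of_comp
  have : Function.Bijective (i.residueFieldMap x).hom :=
    ⟨RingHom.injective (R := Y.residueField (i x)) _, hs⟩
  exact (ConcreteCategory.isIso_iff_bijective _).mpr this

/-- Open immersions, closed immersions and inclusions of fibres are all preimmersions, so this
serves for most of the residue field comparisons below. -/
theorem SameResidueField.of_isPreimmersion (i : X ⟶ Y) [IsPreimmersion i] (h : i ≫ sY = sX)
    (x : X) : SameResidueField sX sY x (i x) := by
  have := isIso_residueFieldMap i x
  refine ⟨asIso (Spec.map (i.residueFieldMap x)), ?_⟩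
  simp [← h]

end SameResidueField

/-! ### The graph of a partial isomorphism -/

section PartialIso

variable {X Y S : Scheme.{u}}

/-- The partial isomorphism `f` is defined at `x` and sends it to `y`. -/
def MapsPoint (f : X.PartialIso Y) (x : X) (y : Y) : Prop :=
  ∃ z : f.source.toScheme, f.source.ι z = x ∧ (f.iso.hom ≫ f.target.ι) z = y

theorem MapsPoint.mem_source {f : X.PartialIso Y} {x : X} {y : Y} (h : MapsPoint f x y) :
    x ∈ f.source := by
  obtain ⟨z, rfl, -⟩ := h
  exact z.2

theorem MapsPoint.symm {f : X.PartialIso Y} {x : X} {y : Y} (h : MapsPoint f x y) :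
    MapsPoint f.symm y x := by
  obtain ⟨z, rfl, rfl⟩ := h
  refine ⟨f.iso.hom z, rfl, ?_⟩
  change (f.iso.inv ≫ f.source.ι) (f.iso.hom z) = _
  rw [← Scheme.Hom.comp_apply, f.iso.hom_inv_id_assoc]

theorem exists_mapsPoint {f : X.PartialIso Y} {x : X} (h : x ∈ f.source) :
    ∃ y, MapsPoint f x y := ⟨_, ⟨x, h⟩, rfl, rfl⟩

theorem exists_mapsPoint' {f : X.PartialIso Y} {y : Y} (h : y ∈ f.target) :
    ∃ x, MapsPoint f x y :=
  (exists_mapsPoint (f := f.symm) h).imp fun _ h ↦ h.symm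

theorem MapsPoint.coheight_eq {f : X.PartialIso Y} {x : X} {y : Y} (h : MapsPoint f x y) :
    Order.coheight y = Order.coheight x := by
  obtain ⟨z, rfl, rfl⟩ := h
  exact (coheight_eq_of_isOpenImmersion (f.iso.hom ≫ f.target.ι)).trans
    (coheight_eq_of_isOpenImmersion f.source.ι).symm

theorem MapsPoint.sameResidueField {f : X.PartialIso Y} {x : X} {y : Y} (h : MapsPoint f x y)
    {sX : X ⟶ S} {sY : Y ⟶ S} (hf : f.IsOver sX sY) : SameResidueField sX sY x y := by
  obtain ⟨z, rfl, rfl⟩ := h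
  refine (SameResidueField.of_isPreimmersion f.source.ι rfl z).symm.trans ?_
  refine SameResidueField.of_isPreimmersion (f.iso.hom ≫ f.target.ι) ?_ _
  rw [Category.assoc, hf]

/-- As `X` is reduced and `Y` separated, a rational map has a largest domain of definition; `F` is
the morphism there, and every representative is a restriction of it. -/
theorem exists_eq_of_toRationalMap_eq [IsReduced X] [Y.IsSeparated] {f g : X.PartialIso Y}
    (h : f.toRationalMap = g.toRationalMap) :
    ∃ (D : X.Opens) (F : D.toScheme ⟶ Y) (hf : f.source ≤ D) (hg : g.source ≤ D),
      X.homOfLE hf ≫ F = f.iso.hom ≫ f.target.ι ∧ X.homOfLE hg ≫ F = g.iso.hom ≫ g.target.ι :=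
  ⟨g.toRationalMap.domain, g.toRationalMap.toPartialMap.hom,
    h ▸ f.toPartialMap.le_domain_toRationalMap, g.toPartialMap.le_domain_toRationalMap, by
      -- The inclusion proofs are generalized so that the equality of rational maps can be rewritten
      -- inside the dependent terms.
      have := f.toPartialMap.toPartialMap_toRationalMap_restrict
      revert this
      generalize_proofs h1 h2 h3
      revert h1 h2 h3
      rw [← h]
      exact fun _ _ _ h ↦ h,
    g.toPartialMap.toPartialMap_toRationalMap_restrict⟩

theorem MapsPoint.eq_of_toRationalMap_eq [IsReduced X] [Y.IsSeparated] {f g : X.PartialIso Y}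
    (h : f.toRationalMap = g.toRationalMap) {x : X} {y y' : Y} (hy : MapsPoint f x y)
    (hy' : MapsPoint g x y') : y = y' := by
  obtain ⟨D, F, hf, hg, h1, h2⟩ := exists_eq_of_toRationalMap_eq h
  obtain ⟨z, rfl, rfl⟩ := hy
  obtain ⟨z', hz, rfl⟩ := hy'
  rw [← h1, ← h2, Scheme.Hom.comp_apply, Scheme.Hom.comp_apply]
  congr 1
  apply D.ι.isOpenEmbedding.injective
  rw [← Scheme.Hom.comp_apply, ← Scheme.Hom.comp_apply, Scheme.homOfLE_ι, Scheme.homOfLE_ι]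
  exact hz.symm

theorem isOver_of_toRationalMap_eq [IsReduced X] [S.IsSeparated] {f g : X.PartialIso Y}
    (h : f.toRationalMap = g.toRationalMap) {sX : X ⟶ S} {sY : Y ⟶ S} (hg : g.IsOver sX sY) :
    f.IsOver sX sY := by
  let : X.Over S := ⟨sX⟩
  let : Y.Over S := ⟨sY⟩
  have h1 : g.toPartialMap.IsOver S := by
    rw [Scheme.PartialMap.isOver_iff]
    exact (Category.assoc _ _ _).trans hg
  rw [← Scheme.PartialMap.isOver_toRationalMap_iff_of_isSeparated] at h1
  change g.toRationalMap.IsOver S at h1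
  rw [← h] at h1
  have h2 := Scheme.PartialMap.isOver_toRationalMap_iff_of_isSeparated.mp h1
  rw [Scheme.PartialMap.isOver_iff] at h2
  exact (Category.assoc _ _ _).symm.trans h2

/-- On a common dense open `W` the two maps agree with one open immersion `j`. Both inverses invert
`j` on its image, a nonempty open set and hence dense in the irreducible `Y`. -/
theorem toRationalMap_symm_eq [IrreducibleSpace X] [IrreducibleSpace Y] {f g : X.PartialIso Y}
    (h : f.toRationalMap = g.toRationalMap) : f.symm.toRationalMap = g.symm.toRationalMap := by
  obtain ⟨W, hW, hf, hg, e⟩ := Scheme.PartialMap.toRationalMap_eq_iff.mp h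
  change W ≤ f.source at hf
  change W ≤ g.source at hg
  replace e : X.homOfLE hf ≫ f.iso.hom ≫ f.target.ι =
    X.homOfLE hg ≫ g.iso.hom ≫ g.target.ι := e
  let j := X.homOfLE hf ≫ f.iso.hom ≫ f.target.ι
  have : IsOpenImmersion j := inferInstanceAs (IsOpenImmersion (_ ≫ _ ≫ _))
  have hjf : j.opensRange ≤ f.target := by
    rintro _ ⟨w, rfl⟩
    exact (f.iso.hom (X.homOfLE hf w)).2
  have hjg : j.opensRange ≤ g.target := by
    rintro _ ⟨w, rfl⟩
    rw [show j = _ from e]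
    exact (g.iso.hom (X.homOfLE hg w)).2
  have hne : (W : Set X).Nonempty := hW.nonempty
  refine Scheme.PartialMap.toRationalMap_eq_iff.mpr ⟨j.opensRange, ?_, hjf, hjg, ?_⟩
  · obtain ⟨w, hw⟩ := hne
    exact j.opensRange.2.dense ⟨_, ⟨⟨w, hw⟩, rfl⟩⟩
  · change Y.homOfLE hjf ≫ f.iso.inv ≫ f.source.ι = Y.homOfLE hjg ≫ g.iso.inv ≫ g.source.ι
    rw [← cancel_epi j.isoOpensRange.hom]
    have h1 : j.isoOpensRange.hom ≫ Y.homOfLE hjf = X.homOfLE hf ≫ f.iso.hom := by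
      rw [← cancel_mono f.target.ι]
      simp [j]
    have h2 : j.isoOpensRange.hom ≫ Y.homOfLE hjg = X.homOfLE hg ≫ g.iso.hom := by
      rw [← cancel_mono g.target.ι]
      simp [j, e]
    rw [reassoc_of% h1, reassoc_of% h2, f.iso.hom_inv_id_assoc, g.iso.hom_inv_id_assoc,
      Scheme.homOfLE_ι, Scheme.homOfLE_ι]

/-- The set of points of codimension one. -/
def codimOne (X : Scheme.{u}) : Set X := {x | Order.coheight x = 1}

/-- The graph of the partial bijection between points of codimension one given by `f`. -/
def codimOneGraph (f : X.PartialIso Y) : Set (X × Y) :=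
  {g | Order.coheight g.1 = 1 ∧ MapsPoint f g.1 g.2}

theorem isCofiniteGraph_codimOneGraph [IsIntegral X] [IsIntegral Y] [NoetherianSpace X]
    [NoetherianSpace Y] [X.IsSeparated] [Y.IsSeparated] (f : X.PartialIso Y) :
    IsCofiniteGraph (codimOne X) (codimOne Y) (codimOneGraph f) where
  fst_mem g hg := hg.1
  snd_mem g hg := hg.2.coheight_eq.trans hg.1
  fst_inj := by
    rintro ⟨x, y⟩ hg ⟨x', y'⟩ hg' (rfl : x = x')
    exact Prod.ext rfl (hg.2.eq_of_toRationalMap_eq rfl hg'.2)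
  snd_inj := by
    rintro ⟨x, y⟩ hg ⟨x', y'⟩ hg' (rfl : y = y')
    exact Prod.ext (hg.2.symm.eq_of_toRationalMap_eq rfl hg'.2.symm) rfl
  finite_fst := by
    refine (finite_of_notMem_source f.source f.dense_source).subset ?_
    rintro x ⟨hx, hx'⟩
    refine ⟨hx, fun h ↦ hx' ?_⟩
    obtain ⟨y, hy⟩ := exists_mapsPoint h
    exact ⟨(x, y), ⟨hx, hy⟩, rfl⟩
  finite_snd := by
    refine (finite_of_notMem_source f.target f.dense_target).subset ?_
    rintro y ⟨hy, hy'⟩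
    refine ⟨hy, fun h ↦ hy' ?_⟩
    obtain ⟨x, hx⟩ := exists_mapsPoint' h
    exact ⟨(x, y), ⟨hx.coheight_eq.symm.trans hy, hx⟩, rfl⟩

/-- The motivic invariant is the index of the partial bijection on points of codimension one. -/
theorem finsum_exDiv_sub_finsum_exDiv [IsIntegral X] [IsIntegral Y] [NoetherianSpace X]
    [NoetherianSpace Y] [X.IsSeparated] [Y.IsSeparated] [S.IsSeparated] {M : Type*}
    [AddCommGroup M] {f : X.PartialIso Y} {sX : X ⟶ S} {sY : Y ⟶ S} (hf : f.IsOver sX sY)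
    {c : X → M} {c' : Y → M} (hc : ∀ x y, SameResidueField sX sY x y → c' y = c x) :
    (∑ᶠ y ∈ exDiv f.symm, c' y) - ∑ᶠ x ∈ exDiv f, c x =
      graphIndex (codimOne X) (codimOne Y) c c' (codimOneGraph f) := by
  -- `exDiv` takes all representatives of the rational map into account, so its complement is the
  -- domain of the union `G` of their graphs. The graph of `f` alone is a cofinite subgraph with the
  -- same index.
  let G : Set (X × Y) := {g | Order.coheight g.1 = 1 ∧
    ∃ ψ : X.PartialIso Y, ψ.toRationalMap = f.toRationalMap ∧ MapsPoint ψ g.1 g.2}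
  have hle : codimOneGraph f ⊆ G := fun g hg ↦ ⟨hg.1, f, rfl, hg.2⟩
  have hG₀ := isCofiniteGraph_codimOneGraph f
  have hG : IsCofiniteGraph (codimOne X) (codimOne Y) G :=
    { fst_mem := fun g hg ↦ hg.1
      snd_mem := by
        rintro g ⟨hg, ψ, -, hψ⟩
        exact hψ.coheight_eq.trans hg
      fst_inj := by
        rintro ⟨x, y⟩ ⟨-, ψ, e, h⟩ ⟨x', y'⟩ ⟨-, ψ', e', h'⟩ (rfl : x = x')
        exact Prod.ext rfl (h.eq_of_toRationalMap_eq (e.trans e'.symm) h')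
      snd_inj := by
        rintro ⟨x, y⟩ ⟨-, ψ, e, h⟩ ⟨x', y'⟩ ⟨-, ψ', e', h'⟩ (rfl : y = y')
        exact Prod.ext (h.symm.eq_of_toRationalMap_eq
          (toRationalMap_symm_eq (e.trans e'.symm)) h'.symm) rfl
      finite_fst := hG₀.finite_fst.subset (Set.sdiff_subset_sdiff_right (Set.image_mono hle))
      finite_snd := hG₀.finite_snd.subset (Set.sdiff_subset_sdiff_right (Set.image_mono hle)) }
  rw [hG.graphIndex_eq hG₀ hle]
  · have h1 : codimOne X \ Prod.fst '' G = exDiv f := by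
      ext x
      refine and_congr_right fun hx ↦ ⟨fun h ψ e hψ ↦ h ?_, ?_⟩
      · obtain ⟨y, hy⟩ := exists_mapsPoint hψ
        exact ⟨(x, y), ⟨hx, ψ, e, hy⟩, rfl⟩
      · rintro h ⟨⟨x, y⟩, ⟨-, ψ, e, hψ⟩, rfl⟩
        exact h ψ e hψ.mem_source
    have h2 : codimOne Y \ Prod.snd '' G = exDiv f.symm := by
      ext y
      refine and_congr_right fun hy ↦ ⟨fun h ψ e hψ ↦ h ?_, ?_⟩
      · obtain ⟨x, hx⟩ := exists_mapsPoint hψ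
        exact ⟨(x, y), ⟨hx.coheight_eq.trans hy, ψ.symm, toRationalMap_symm_eq e, hx.symm⟩, rfl⟩
      · rintro h ⟨⟨x, y⟩, ⟨-, ψ, e, hψ⟩, rfl⟩
        exact h ψ.symm (toRationalMap_symm_eq e) hψ.symm.mem_source
    rw [graphIndex, h1, h2]
  · rintro ⟨x, y⟩ ⟨-, ψ, e, h⟩
    exact hc _ _ (h.sameResidueField (isOver_of_toRationalMap_eq e hf))

end PartialIso

/-! ### Birational classes and residue fields -/

theorem exists_iso_residueField_genericPoint (Y : Scheme.{u}) [IsIntegral Y] :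
    ∃ e : Spec Y.functionField ≅ Spec (Y.residueField (genericPoint Y)),
      e.hom ≫ Y.fromSpecResidueField _ = Y.fromSpecStalk (genericPoint Y) := by
  have : IsIso (Y.residue (genericPoint Y)) := by
    have : Function.Bijective (Y.residue (genericPoint Y)).hom :=
      ⟨RingHom.injective (R := Y.functionField) _, Y.residue_surjective _⟩
    exact (ConcreteCategory.isIso_iff_bijective _).mpr this
  refine ⟨(asIso (Spec.map (Y.residue (genericPoint Y)))).symm, ?_⟩
  rw [Iso.symm_hom, Iso.inv_comp_eq]
  rfl

/-- The residue field at the generic point is the function field, and an isomorphism of function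
fields over `S` spreads out. -/
theorem birationalOver_of_sameResidueField {S X Y : Scheme.{u}} [IsIntegral X] [IsIntegral Y]
    {sX : X ⟶ S} {sY : Y ⟶ S} [LocallyOfFiniteType sX] [LocallyOfFiniteType sY]
    [IsSeparated sX] [IsSeparated sY]
    (h : SameResidueField sX sY (genericPoint X) (genericPoint Y)) :
    Scheme.BirationalOver sX sY := by
  obtain ⟨e, he⟩ := h
  obtain ⟨a, ha⟩ := exists_iso_residueField_genericPoint X
  obtain ⟨b, hb⟩ := exists_iso_residueField_genericPoint Y
  refine birationalOver_of_functionField sX sY (a ≪≫ e ≪≫ b.symm) ?_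
  simp only [Iso.trans_hom, Iso.symm_hom, Category.assoc]
  rw [← hb, ← ha]
  simp [he]

theorem range_subvarietyι {S : Scheme.{u}} (X : VarietyOver S) (x : X.X) :
    Set.range (X.subvarietyι x) = closure {x} := by
  have h := Scheme.IdealSheafData.range_subschemeι
    (Scheme.IdealSheafData.vanishingIdeal (Closeds.closure {x}))
  refine Eq.trans h ?_
  simp

instance {S : Scheme.{u}} (X : VarietyOver S) (x : X.X) : IsClosedImmersion (X.subvarietyι x) :=
  inferInstanceAs (IsClosedImmersion (Scheme.IdealSheafData.subschemeι _))

theorem subvarietyι_genericPoint {S : Scheme.{u}} (X : VarietyOver S) (x : X.X) :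
    X.subvarietyι x (genericPoint (X.subvariety x).X) = x := by
  have h := (genericPoint_spec (X.subvariety x).X).image (X.subvarietyι x).continuous
  rw [Set.image_univ, range_subvarietyι, closure_closure] at h
  exact h.eq (show IsGenericPoint x (closure {x}) from rfl)

theorem sameResidueField_subvariety {S : Scheme.{u}} (X : VarietyOver S) (x : X.X) :
    SameResidueField (X.subvariety x).str X.str (genericPoint (X.subvariety x).X) x := by
  have h := SameResidueField.of_isPreimmersion (sX := (X.subvariety x).str) (sY := X.str)
    (X.subvarietyι x) rfl (genericPoint (X.subvariety x).X)
  rwa [subvarietyι_genericPoint] at h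

theorem Burn.cls_eq_of_sameResidueField {k : Type u} [Field k] {X Y : Variety k}
    (h : SameResidueField X.str Y.str (genericPoint X.X) (genericPoint Y.X)) :
    Burn.cls X = Burn.cls Y :=
  congrArg FreeAbelianGroup.of
    (Quotient.sound (s := birationalSetoid k) (birationalOver_of_sameResidueField h))

/-- The function field of the closure of a point is the residue field of that point, so only the
latter, over `k`, matters for the class. -/
theorem Burn.cls_subvariety_eq {k : Type u} [Field k] {X Y : Variety k} {x : X.X} {y : Y.X}
    (h : SameResidueField X.str Y.str x y) :
    Burn.cls (X.subvariety x) = Burn.cls (Y.subvariety y) :=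
  cls_eq_of_sameResidueField
    (((sameResidueField_subvariety X x).trans h).trans (sameResidueField_subvariety Y y).symm)

theorem IsModel.sameResidueField {k : Type u} [Field k] {Y : Variety k} {W : RelVariety k}
    (h : IsModel Y W) : SameResidueField Y.str (W.toVariety.str ≫ W.base) (genericPoint Y.X)
      (genericPoint W.toVariety.X) := by
  obtain ⟨e, he⟩ := h
  obtain ⟨a, ha⟩ := exists_iso_residueField_genericPoint Y.X
  obtain ⟨b, hb⟩ := exists_iso_residueField_genericPoint W.toVariety.X
  refine ⟨a.symm ≪≫ e ≪≫ b, ?_⟩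
  simp only [Iso.trans_hom, Iso.symm_hom, Category.assoc]
  rw [reassoc_of% hb, he, ← ha]
  simp

theorem forget_cls_subvariety {k : Type u} [Field k] {W : RelVariety k} {X : Variety k}
    {w : W.toVariety.X} {x : X.X}
    (h : SameResidueField (W.toVariety.str ≫ W.base) X.str w x) :
    BigBurn.forget (BigBurn.cls (W.subvariety w)) = Burn.cls (X.subvariety x) := by
  have h1 : BigBurn.forget (BigBurn.cls (W.subvariety w)) =
      Burn.cls (exists_isModel (W.subvariety w)).choose :=
    FreeAbelianGroup.map_of_apply _
  rw [h1]
  refine Burn.cls_eq_of_sameResidueField ?_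
  refine (exists_isModel (W.subvariety w)).choose_spec.sameResidueField.trans ?_
  refine SameResidueField.trans ?_ (h.trans (sameResidueField_subvariety X x).symm)
  exact (sameResidueField_subvariety W.toVariety w).comp W.base

/-! ### Noetherianity and separatedness of varieties -/

theorem VarietyOver.noetherianSpace {S : Scheme.{u}} [IsLocallyNoetherian S] [CompactSpace S]
    (X : VarietyOver S) : NoetherianSpace X.X := by
  have := LocallyOfFiniteType.isLocallyNoetherian X.str
  have : CompactSpace X.X := QuasiCompact.compactSpace_of_compactSpace X.str
  have : IsNoetherian X.X := {}
  infer_instance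

theorem VarietyOver.isSeparated_scheme {S : Scheme.{u}} [S.IsSeparated] (X : VarietyOver S) :
    X.X.IsSeparated := by
  rw [Scheme.isSeparated_iff]
  have : IsSeparated (X.str ≫ terminal.from S) := inferInstance
  rwa [terminal.hom_ext (terminal.from X.X) (X.str ≫ terminal.from S)]

instance {k : Type u} [Field k] (X : Variety k) : NoetherianSpace X.X := X.noetherianSpace

instance {k : Type u} [Field k] (X : Variety k) : X.X.IsSeparated := X.isSeparated_scheme

instance {k : Type u} [Field k] (W : RelVariety k) : NoetherianSpace W.toVariety.X := by
  let := W.isField.toField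
  have : IsNoetherianRing W.F := inferInstance
  exact W.toVariety.noetherianSpace

instance {k : Type u} [Field k] (W : RelVariety k) : W.toVariety.X.IsSeparated :=
  W.toVariety.isSeparated_scheme

/-- The class in the Burnside group of the closure of a point. -/
noncomputable def pointClass {k : Type u} [Field k] (X : Variety k) (x : X.X) : Burn k :=
  Burn.cls (X.subvariety x)

theorem BirMap.c_eq_graphIndex {k : Type u} [Field k] {X Y : Variety k} (f : BirMap X Y) :
    f.c = graphIndex (codimOne X.X) (codimOne Y.X) (pointClass X) (pointClass Y)
      (codimOneGraph f.toPartialIso) :=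
  finsum_exDiv_sub_finsum_exDiv f.isOver fun _ _ h ↦ (Burn.cls_subvariety_eq h).symm

/-- The maps `a₁` and `a₂` realise points of `W₁` and `W₂` as points of one variety `X`; they will
be the inclusion of the generic fibre. Forgetting the base field leaves only residue fields over
`k`, so the index can use classes of points of `X`. -/
theorem RelBirMap.forget_c_eq_graphIndex {k : Type u} [Field k] {W₁ W₂ : RelVariety k}
    (f : RelBirMap W₁ W₂) {X : Variety k} (a₁ : W₁.toVariety.X → X.X) (a₂ : W₂.toVariety.X → X.X)
    (h₁ : ∀ w, SameResidueField (W₁.toVariety.str ≫ W₁.base) X.str w (a₁ w))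
    (h₂ : ∀ w, SameResidueField (W₂.toVariety.str ≫ W₂.base) X.str w (a₂ w)) :
    BigBurn.forget f.c = graphIndex (codimOne W₁.toVariety.X) (codimOne W₂.toVariety.X)
      (fun w ↦ pointClass X (a₁ w)) (fun w ↦ pointClass X (a₂ w)) (codimOneGraph f.map) := by
  have hf : f.map.IsOver (W₁.toVariety.str ≫ W₁.base) (W₂.toVariety.str ≫ W₂.base) := by
    have h := congrArg (· ≫ W₂.base) f.isOver
    simp only [Category.assoc, f.baseIso_over] at h
    exact h
  rw [← finsum_exDiv_sub_finsum_exDiv hf (c := fun w ↦ pointClass X (a₁ w))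
    (c' := fun w ↦ pointClass X (a₂ w)) fun x y h ↦ Burn.cls_subvariety_eq ((h₂ y).symm.trans (h.symm.trans (h₁ x)))]
  rw [RelBirMap.c, map_sub, AddMonoidHom.map_finsum_mem _ _ (exDiv_finite _),
    AddMonoidHom.map_finsum_mem _ _ (exDiv_finite _)]
  congr 1
  · exact finsum_mem_congr rfl fun w _ ↦ forget_cls_subvariety (h₂ w)
  · exact finsum_mem_congr rfl fun w _ ↦ forget_cls_subvariety (h₁ w)

/-! ### Points of codimension one of the generic fibre -/

theorem le_genericPoint {X : Scheme.{u}} [IsIntegral X] (x : X) : x ≤ genericPoint X :=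
  (genericPoint_spec X).specializes trivial

theorem coheight_genericPoint {X : Scheme.{u}} [IsIntegral X] :
    Order.coheight (genericPoint X) = 0 :=
  Order.coheight_eq_zero.mpr fun x _ ↦ le_genericPoint x

theorem scheme_le_antisymm {X : Scheme.{u}} {x y : X} (h : x ≤ y) (h' : y ≤ x) : x = y :=
  ((show x ⤳ y from h').antisymm (show y ⤳ x from h)).eq

/-- In the specialization order the generic point is the top element. The criterion mentions only
generizations, and therefore passes through embeddings and flat morphisms. -/
theorem coheight_eq_one_iff {X : Scheme.{u}} [IsIntegral X] {x : X} :
    Order.coheight x = 1 ↔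
      x ≠ genericPoint X ∧ ∀ y : X, y ⤳ x → y = x ∨ y = genericPoint X := by
  constructor
  · intro hx
    refine ⟨?_, fun y hyx ↦ ?_⟩
    · rintro rfl
      rw [coheight_genericPoint] at hx
      exact zero_ne_one hx
    · by_contra! h
      have h1 : x < y := lt_of_le_not_ge hyx fun h' ↦ h.1 (scheme_le_antisymm h' hyx)
      have h2 : y < genericPoint X :=
        lt_of_le_not_ge (le_genericPoint y) fun h' ↦ h.2 (scheme_le_antisymm (le_genericPoint y) h')
      have h3 := Order.coheight_add_one_le h1
      have h4 := Order.coheight_add_one_le h2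
      rw [hx] at h3
      rw [coheight_genericPoint, zero_add] at h4
      have h5 : (1 : ℕ∞) + 1 ≤ 1 := le_trans (by gcongr) h3
      exact absurd h5 (by decide)
  · rintro ⟨h1, h2⟩
    apply le_antisymm
    · rw [← Nat.cast_one (R := ℕ∞), Order.coheight_le_coe_iff]
      intro y hy
      rcases h2 y hy.le with rfl | rfl
      · exact absurd hy (lt_irrefl _)
      · rw [coheight_genericPoint]
        exact zero_lt_one
    · have h3 : x < genericPoint X :=
        lt_of_le_not_ge (le_genericPoint x) fun h ↦ h1 (scheme_le_antisymm (le_genericPoint x) h)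
      exact le_trans (by simp) (Order.coheight_add_one_le h3)

theorem MapsPoint.of_restriction {X Y X' Y' : Scheme.{u}} {f : X.PartialIso Y}
    {g : X'.PartialIso Y'} (i : X' ⟶ X) (j : Y' ⟶ Y) (hle : g.source ≤ i ⁻¹ᵁ f.source)
    (h : g.iso.hom ≫ g.target.ι ≫ j = i.resLE f.source g.source hle ≫ f.iso.hom ≫ f.target.ι)
    {v : X'} {w : Y'} (hvw : MapsPoint g v w) : MapsPoint f (i v) (j w) := by
  obtain ⟨z, rfl, rfl⟩ := hvw
  refine ⟨i.resLE f.source g.source hle z, ?_, ?_⟩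
  · rw [← Scheme.Hom.comp_apply, Scheme.Hom.resLE_comp_ι, Scheme.Hom.comp_apply]
  · rw [← Scheme.Hom.comp_apply, ← h]
    simp only [Scheme.Hom.comp_apply]

theorem mem_range_fiberι_iff {X B : Scheme.{u}} (f : X ⟶ B) {b : B} {x : X} :
    x ∈ Set.range (f.fiberι b) ↔ f x = b := by
  rw [f.range_fiberι]
  rfl

section GenericFiber

variable {X B : Scheme.{u}} [IsIntegral X] [IsIntegral B] (f : X ⟶ B)

theorem fiberι_genericPoint [IsDominant f] [IsIntegral (f.fiber (genericPoint B))] :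
    f.fiberι (genericPoint B) (genericPoint (f.fiber (genericPoint B))) = genericPoint X := by
  obtain ⟨g, hg⟩ := (mem_range_fiberι_iff f).mpr (apply_genericPoint_of_isDominant f)
  have h : genericPoint (f.fiber (genericPoint B)) ⤳ g := (genericPoint_spec _).specializes trivial
  have h' := h.map (f.fiberι (genericPoint B)).continuous
  rw [hg] at h'
  exact scheme_le_antisymm (le_genericPoint _) h'

/-- A generization of a point over the generic point of `B` again lies over it, so such a point has
the same generizations in `X` and in the generic fibre. -/
theorem coheight_fiberι_eq_one_iff [IsDominant f] [IsIntegral (f.fiber (genericPoint B))]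
    (w : f.fiber (genericPoint B)) :
    Order.coheight (f.fiberι (genericPoint B) w) = 1 ↔ Order.coheight w = 1 := by
  have hemb := (f.fiberι (genericPoint B)).isEmbedding
  rw [coheight_eq_one_iff, coheight_eq_one_iff, ← fiberι_genericPoint f]
  refine and_congr (not_congr hemb.injective.eq_iff) ⟨fun h v hv ↦ ?_, fun h y hy ↦ ?_⟩
  · simpa only [hemb.injective.eq_iff] using h _ (hemb.isInducing.specializes_iff.mpr hv)
  · have h1 : f y = genericPoint B := by
      refine scheme_le_antisymm (le_genericPoint _) ?_
      have := hy.map f.continuous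
      rwa [(mem_range_fiberι_iff f).mp ⟨w, rfl⟩] at this
    obtain ⟨v, rfl⟩ := (mem_range_fiberι_iff f).mpr h1
    simpa only [hemb.injective.eq_iff] using h _ (hemb.isInducing.specializes_iff.mp hy)

end GenericFiber

/-! ### Horizontal and vertical divisors -/

section Vertical

variable {k : Type u} [Field k] {X B : Variety k} (π : DominantHom X B)

/-- The generic points of the prime divisors of `X` dominating `B`. -/
def horizontalPoints : Set X.X := {x | Order.coheight x = 1 ∧ π.hom x = genericPoint B.X}

/-- The generic points of the prime divisors of `X` that do not dominate `B`. -/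
def verticalPoints : Set X.X := {x | Order.coheight x = 1 ∧ π.hom x ≠ genericPoint B.X}

theorem fiberι_image_codimOne :
    π.hom.fiberι (genericPoint B.X) '' codimOne π.genericFiber.toVariety.X =
      horizontalPoints π := by
  have := isIntegral_fiber_genericPoint π.hom
  ext x
  constructor
  · rintro ⟨w, hw, rfl⟩
    exact ⟨(coheight_fiberι_eq_one_iff π.hom w).mpr hw, (mem_range_fiberι_iff _).mp ⟨w, rfl⟩⟩
  · rintro ⟨hx, hx'⟩
    obtain ⟨w, rfl⟩ := (mem_range_fiberι_iff _).mpr hx'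
    exact ⟨w, (coheight_fiberι_eq_one_iff π.hom w).mp hx, rfl⟩

theorem sameResidueField_fiberι (w : π.genericFiber.toVariety.X) :
    SameResidueField (π.genericFiber.toVariety.str ≫ π.genericFiber.base) X.str w
      (π.hom.fiberι (genericPoint B.X) w) := by
  refine SameResidueField.of_isPreimmersion (X := π.hom.fiber (genericPoint B.X))
    (π.hom.fiberι (genericPoint B.X)) ?_ w
  change _ = π.hom.fiberToSpecResidueField _ ≫ B.X.fromSpecResidueField _ ≫ B.str
  rw [← Scheme.Hom.fiber_fac_assoc, π.comp_str]

variable {π}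

theorem SquareBirMap.exists_mapsPoint_base (φ : SquareBirMap π π) :
    ∃ U : X.X.Opens, Dense (U : Set X.X) ∧ ∀ x ∈ U, ∀ y, MapsPoint φ.total.toPartialIso x y →
      MapsPoint φ.base.toPartialIso (π.hom x) (π.hom y) := by
  obtain ⟨U, hU, h₁, h₂, h⟩ := φ.comm
  refine ⟨U, hU, ?_⟩
  rintro x hx y ⟨z, hz, rfl⟩
  let u : U.toScheme := ⟨x, hx⟩
  have hu : X.X.homOfLE h₁ u = z := by
    apply φ.total.source.ι.isOpenEmbedding.injective
    rw [← Scheme.Hom.comp_apply, Scheme.homOfLE_ι]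
    exact hz.symm
  refine ⟨π.hom.resLE φ.base.source U h₂ u, ?_, ?_⟩
  · rw [← Scheme.Hom.comp_apply, Scheme.Hom.resLE_comp_ι]
    rfl
  · rw [← Scheme.Hom.comp_apply, ← h, ← hu]
    simp only [Scheme.Hom.comp_apply]

theorem IsGenericRestriction.mapsPoint {φ : SquareBirMap π π}
    {ψ : RelBirMap π.genericFiber π.genericFiber} (h : IsGenericRestriction φ ψ)
    {v w : π.genericFiber.toVariety.X} (hvw : MapsPoint ψ.map v w) :
    MapsPoint φ.total.toPartialIso (π.hom.fiberι (genericPoint B.X) v)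
      (π.hom.fiberι (genericPoint B.X) w) := by
  obtain ⟨hle, h⟩ := h
  exact MapsPoint.of_restriction (X' := π.genericFiber.toVariety.X)
    (Y' := π.genericFiber.toVariety.X) (π.hom.fiberι (genericPoint B.X))
    (π.hom.fiberι (genericPoint B.X)) hle h hvw

/-- The graphs of `φ` and of `φ^η` are shrunk until the horizontal part of the first is the image of
the second. The horizontal part of the index is then `c_hor`, and the vertical part is what remains.
-/
theorem SquareBirMap.cVer_eq_graphIndex (φ : SquareBirMap π π) :
    ∃ G : Set (X.X × X.X), IsCofiniteGraph (verticalPoints π) (verticalPoints π) G ∧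
      (∀ g ∈ G, MapsPoint φ.base.toPartialIso (π.hom g.1) (π.hom g.2)) ∧
      (∀ g ∈ G, pointClass X g.2 = pointClass X g.1) ∧
      φ.cVer = graphIndex (verticalPoints π) (verticalPoints π) (pointClass X) (pointClass X) G := by
  obtain ⟨U, hU, hbase⟩ := φ.exists_mapsPoint_base
  have hψ : IsGenericRestriction φ φ.genericFiber := (exists_isGenericRestriction φ).choose_spec
  let ι : π.genericFiber.toVariety.X → X.X := π.hom.fiberι (genericPoint B.X)
  have hι : Function.Injective ι := (π.hom.fiberι (genericPoint B.X)).isEmbedding.injective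
  let H := horizontalPoints π
  let Gψ := codimOneGraph φ.genericFiber.map
  have hGψ : IsCofiniteGraph _ _ Gψ := isCofiniteGraph_codimOneGraph φ.genericFiber.map
  let Gφ := codimOneGraph φ.total.toPartialIso
  have hGφ : IsCofiniteGraph _ _ Gφ := isCofiniteGraph_codimOneGraph φ.total.toPartialIso
  have hUfin : (codimOne X.X \ (U : Set X.X)).Finite :=
    (finite_of_notMem_source U hU).subset fun x hx ↦ hx
  -- Only sources in `U` are kept, because compatibility with the base map is known there;
  -- `Set.univ` puts no condition on targets.
  let Gψ' := {g ∈ Gψ | ι g.1 ∈ U ∧ g.2 ∈ Set.univ}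
  have hUψ : (codimOne π.genericFiber.toVariety.X \ ι ⁻¹' U).Finite :=
    Set.Finite.of_finite_image (f := ι) (hUfin.subset (by
      rintro _ ⟨w, ⟨hw, hw'⟩, rfl⟩
      have : ι w ∈ horizontalPoints π := by
        rw [← fiberι_image_codimOne]
        exact ⟨w, hw, rfl⟩
      exact ⟨this.1, hw'⟩)) hι.injOn
  have hGψ' : IsCofiniteGraph _ _ Gψ' := hGψ.restrict (A := ι ⁻¹' U) (A' := Set.univ) hUψ (by simp)
  have hGψH := hGψ'.image hι.injOn hι.injOn
  have hHimage : ι '' codimOne π.genericFiber.toVariety.X = H := fiberι_image_codimOne π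
  rw [hHimage] at hGψH
  -- Horizontal points are kept only if the shrunk graph of the generic fibre is defined at them;
  -- this makes the equality `hGH` exact.
  let A : Set X.X := {x | x ∈ U ∧ (x ∈ H → x ∈ Prod.fst '' (Prod.map ι ι '' Gψ'))}
  have hA : (codimOne X.X \ A).Finite := by
    refine (hUfin.union hGψH.finite_fst).subset ?_
    rintro x ⟨hx, hx'⟩
    by_cases h : x ∈ U
    · by_cases hH : x ∈ H
      · exact Or.inr ⟨hH, fun h' ↦ hx' ⟨h, fun _ ↦ h'⟩⟩
      · exact absurd ⟨h, fun h' ↦ absurd h' hH⟩ hx'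
    · exact Or.inl ⟨hx, h⟩
  let G := {g ∈ Gφ | g.1 ∈ A ∧ g.2 ∈ Set.univ}
  have hG : IsCofiniteGraph (codimOne X.X) (codimOne X.X) G := hGφ.restrict hA (by simp)
  have hGbase : ∀ g ∈ G, MapsPoint φ.base.toPartialIso (π.hom g.1) (π.hom g.2) :=
    fun g hg ↦ hbase _ hg.2.1.1 _ hg.1.2
  have hHG : ∀ g ∈ G, g.1 ∈ H ↔ g.2 ∈ H := by
    intro g hg
    have h := hGbase g hg
    refine and_congr ?_ ?_
    · rw [hg.1.2.coheight_eq]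
    -- The base map preserves codimension, and the generic point is the only point of codimension
    -- zero; so horizontal points correspond to horizontal points.
    · have key : ∀ b : B.X, b = genericPoint B.X ↔ Order.coheight b = 0 := by
        refine fun b ↦ ⟨fun h ↦ h ▸ coheight_genericPoint, fun h ↦ ?_⟩
        exact scheme_le_antisymm (le_genericPoint b)
          (Order.coheight_eq_zero.mp h (le_genericPoint b))
      rw [key, key, h.coheight_eq]
  have hHsub : H ⊆ codimOne X.X := fun x hx ↦ hx.1
  have hcompl : codimOne X.X \ H = verticalPoints π := by
    ext x
    exact and_congr_right fun hx ↦ not_congr (and_iff_right hx)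
  have hGH : {g ∈ G | g.1 ∈ H} = Prod.map ι ι '' Gψ' := by
    ext g
    constructor
    · rintro ⟨hg, hgH⟩
      obtain ⟨_, ⟨g', hg', rfl⟩, e⟩ := hg.2.1.2 hgH
      refine ⟨g', hg', ?_⟩
      have h1 := hg.1.2
      have h2 := hψ.mapsPoint hg'.1.2
      refine Prod.ext e ?_
      rw [← e] at h1
      exact h2.eq_of_toRationalMap_eq rfl h1
    · rintro ⟨g', hg', rfl⟩
      have hH : ι g'.1 ∈ H := hHimage ▸ ⟨_, hGψ.fst_mem _ hg'.1, rfl⟩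
      exact ⟨⟨⟨hH.1, hψ.mapsPoint hg'.1.2⟩, ⟨hg'.2.1, fun _ ↦ ⟨_, ⟨g', hg', rfl⟩, rfl⟩⟩, trivial⟩,
        hH⟩
  have htotal : φ.total.c = graphIndex (codimOne X.X) (codimOne X.X) (pointClass X) (pointClass X)
      G := by
    rw [φ.total.c_eq_graphIndex]
    exact (hGφ.graphIndex_eq hG (fun g hg ↦ hg.1) fun g hg ↦
      (Burn.cls_subvariety_eq (hg.2.sameResidueField φ.total.isOver)).symm).symm
  have hhor : φ.cHor = graphIndex H H (pointClass X) (pointClass X) {g ∈ G | g.1 ∈ H} := by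
    rw [SquareBirMap.cHor, φ.genericFiber.forget_c_eq_graphIndex ι ι (sameResidueField_fiberι π)
      (sameResidueField_fiberι π), hGH]
    rw [← hGψ.graphIndex_eq hGψ' (fun g hg ↦ hg.1) fun g hg ↦
      (Burn.cls_subvariety_eq ((hψ.mapsPoint hg.2).sameResidueField φ.total.isOver)).symm]
    have h := map_graphIndex_image hGψ' hι.injOn hι.injOn (c := fun w ↦ pointClass X (ι w))
      (c' := fun w ↦ pointClass X (ι w)) (d := pointClass X) (d' := pointClass X)
      (AddMonoidHom.id _) (AddMonoidHom.id _) (fun _ _ ↦ rfl) (fun _ _ ↦ rfl)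
    rw [hHimage] at h
    exact h
  refine ⟨{g ∈ G | g.1 ∉ H}, ?_, fun g hg ↦ hGbase g hg.1, fun g hg ↦
    (Burn.cls_subvariety_eq (hg.1.1.2.sameResidueField φ.total.isOver)).symm, ?_⟩
  · rw [← hcompl]
    exact
      { fst_mem := fun g hg ↦ ⟨hG.fst_mem g hg.1, hg.2⟩
        snd_mem := fun g hg ↦ ⟨hG.snd_mem g hg.1, fun h ↦ hg.2 ((hHG g hg.1).mpr h)⟩
        fst_inj := hG.fst_inj.mono fun g hg ↦ hg.1
        snd_inj := hG.snd_inj.mono fun g hg ↦ hg.1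
        finite_fst := by
          refine hG.finite_fst.subset ?_
          rintro x ⟨⟨hx, hxH⟩, hx'⟩
          refine ⟨hx, ?_⟩
          rintro ⟨g, hg, rfl⟩
          exact hx' ⟨g, ⟨hg, hxH⟩, rfl⟩
        finite_snd := by
          refine hG.finite_snd.subset ?_
          rintro x ⟨⟨hx, hxH⟩, hx'⟩
          refine ⟨hx, ?_⟩
          rintro ⟨g, hg, rfl⟩
          exact hx' ⟨g, ⟨hg, fun h ↦ hxH ((hHG g hg).mp h)⟩, rfl⟩ }
  · rw [SquareBirMap.cVer, htotal, hhor, graphIndex_add_compl hG hHsub hHsub hHG, hcompl]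
    abel

end Vertical

/-! ### Codimension in fibres -/

/-- A prime of `S` containing the extension of `I` contracts to a prime containing `I`, which is
maximal by minimality; by `h` the prime itself is maximal. -/
theorem mem_minimalPrimes_of_comap_eq_maximalIdeal {R S : Type*} [CommRing R] [CommRing S]
    [IsLocalRing R] [IsLocalRing S] (φ : R →+* S) [IsLocalHom φ]
    (h : ∀ Q : Ideal S, Q.IsPrime → Q.comap φ = IsLocalRing.maximalIdeal R →
      Q = IsLocalRing.maximalIdeal S) {I : Ideal R}
    (hI : IsLocalRing.maximalIdeal R ∈ I.minimalPrimes) :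
    IsLocalRing.maximalIdeal S ∈ (I.map φ).minimalPrimes := by
  have hc : (IsLocalRing.maximalIdeal S).comap φ = IsLocalRing.maximalIdeal R :=
    ((IsLocalRing.local_hom_TFAE φ).out 0 4).mp ‹_›
  refine ⟨⟨inferInstance, ?_⟩, fun Q ⟨hQ, hIQ⟩ hle ↦ ?_⟩
  · rw [Ideal.map_le_iff_le_comap, hc]
    exact hI.1.2
  · refine (h Q hQ (le_antisymm (IsLocalRing.le_maximalIdeal (hQ.comap φ).ne_top) ?_)).ge
    exact hI.2 ⟨hQ.comap φ, Ideal.map_le_iff_le_comap.mp hIQ⟩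
      (IsLocalRing.le_maximalIdeal (hQ.comap φ).ne_top)

/-- The maximal ideal of `R` is minimal over an ideal with `dim R` generators. Their images generate
an ideal of `S` over which the maximal ideal is minimal, and Krull's height theorem bounds its
height. -/
theorem ringKrullDim_le_of_comap_eq_maximalIdeal {R S : Type*} [CommRing R] [CommRing S]
    [IsLocalRing R] [IsLocalRing S] [IsNoetherianRing R] [IsNoetherianRing S] (φ : R →+* S)
    [IsLocalHom φ] (h : ∀ Q : Ideal S, Q.IsPrime → Q.comap φ = IsLocalRing.maximalIdeal R →
      Q = IsLocalRing.maximalIdeal S) : ringKrullDim S ≤ ringKrullDim R := by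
  classical
  obtain ⟨s, hs, hcard⟩ :=
    (IsLocalRing.maximalIdeal R).exists_finset_card_eq_height_of_isNoetherianRing
  have h1 := mem_minimalPrimes_of_comap_eq_maximalIdeal φ h hs
  rw [Ideal.map_span, ← Finset.coe_image] at h1
  have h2 := Ideal.height_le_card_of_mem_minimalPrimes_span_finset h1
  rw [← IsLocalRing.maximalIdeal_height_eq_ringKrullDim,
    ← IsLocalRing.maximalIdeal_height_eq_ringKrullDim, ← hcard]
  refine WithBot.coe_le_coe.mpr (h2.trans ?_)
  exact_mod_cast Finset.card_image_le

/-- A generic point of a component of a fibre has codimension at most that of its image. -/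
theorem coheight_le_of_forall_specializes {X B : Scheme.{u}} [IsLocallyNoetherian X]
    [IsLocallyNoetherian B] (f : X ⟶ B) (x : X) (h : ∀ y, y ⤳ x → f y = f x → y = x) :
    Order.coheight x ≤ Order.coheight (f x) := by
  have key : ringKrullDim (X.presheaf.stalk x) ≤ ringKrullDim (B.presheaf.stalk (f x)) := by
    refine ringKrullDim_le_of_comap_eq_maximalIdeal (f.stalkMap x).hom fun Q hQ hcomap ↦ ?_
    -- Primes of the local ring at `x` are the generizations of `x`; those over the maximal ideal of
    -- the local ring at `f x` lie in the same fibre, so `h` applies.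
    let q : Spec (X.presheaf.stalk x) := (⟨Q, hQ⟩ : PrimeSpectrum _)
    have hq : Spec.map (f.stalkMap x) q = IsLocalRing.closedPoint (B.presheaf.stalk (f x)) :=
      PrimeSpectrum.ext hcomap
    have h1 : f (X.fromSpecStalk x q) = f x := by
      rw [← Scheme.Hom.comp_apply, ← Scheme.SpecMap_stalkMap_fromSpecStalk,
        Scheme.Hom.comp_apply, hq, Scheme.fromSpecStalk_closedPoint]
    have h2 : X.fromSpecStalk x q ⤳ x := by
      have : X.fromSpecStalk x q ∈ Set.range (X.fromSpecStalk x) := ⟨q, rfl⟩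
      rwa [Scheme.range_fromSpecStalk] at this
    have h3 := h _ h2 h1
    have h4 : q = IsLocalRing.closedPoint (X.presheaf.stalk x) := by
      apply (X.fromSpecStalk x).isEmbedding.injective
      rw [h3, Scheme.fromSpecStalk_closedPoint]
    exact congrArg PrimeSpectrum.asIdeal h4
  rw [ringKrullDim_stalk_eq_coheight, ringKrullDim_stalk_eq_coheight] at key
  exact WithBot.coe_le_coe.mp key

/-- Going down: a generization of `f x` lifts to one of `x`, which is `x` or the generic point of
`X`. -/
theorem coheight_eq_one_of_flat {X B : Scheme.{u}} [IsIntegral X] [IsIntegral B] (f : X ⟶ B)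
    [IsDominant f] [Flat f] {x : X} (hx : Order.coheight x = 1) (h : f x ≠ genericPoint B) :
    Order.coheight (f x) = 1 := by
  rw [coheight_eq_one_iff] at hx ⊢
  refine ⟨h, fun b hb ↦ ?_⟩
  obtain ⟨y, hy, rfl⟩ := (Flat.generalizingMap f) hb
  rcases hx.2 y hy with rfl | rfl
  · exact Or.inl rfl
  · exact Or.inr (apply_genericPoint_of_isDominant f)

/-! ### Products with a fixed variety -/

theorem surjective_str {k : Type u} [Field k] (F : Variety k) : Surjective F.str :=
  ⟨fun _ ↦ ⟨genericPoint F.X, Subsingleton.elim (α := PrimeSpectrum k) _ _⟩⟩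

/-- Generic points are expressed by `∀ q, p ⤳ q` because the products with `F` and the preimages of
divisors are not known to be integral. -/
theorem mem_of_forall_specializes {α : Type*} [TopologicalSpace α] {p : α} (h : ∀ q, p ⤳ q)
    {U : Set α} (hU : IsOpen U) (hne : U.Nonempty) : p ∈ U := by
  obtain ⟨q, hq⟩ := hne
  exact (h q).mem_open hU hq

theorem exists_generic_preimage {W P : Scheme.{u}} (j : W ⟶ P) [IsOpenImmersion j] [Nonempty W]
    {p : P} (hp : ∀ q, p ⤳ q) : ∃ w, j w = p ∧ ∀ v, w ⤳ v := by
  obtain ⟨w, rfl⟩ := mem_of_forall_specializes hp j.isOpenEmbedding.isOpen_range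
    (Set.range_nonempty j)
  exact ⟨w, rfl, fun v ↦ j.isEmbedding.isInducing.specializes_iff.mp (hp _)⟩

/-- The generic points of `D × F` and `D' × F` have isomorphic residue fields if `D` and `D'` are
birational. -/
theorem sameResidueField_pullback {k : Type u} [Field k] {D D' F : Variety k}
    (h : Scheme.BirationalOver D.str D'.str) {p : ↑(pullback D.str F.str)}
    {p' : ↑(pullback D'.str F.str)} (hp : ∀ q, p ⤳ q) (hp' : ∀ q, p' ⤳ q) :
    SameResidueField (pullback.fst D.str F.str ≫ D.str) (pullback.fst D'.str F.str ≫ D'.str)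
      p p' := by
  obtain ⟨f, hf⟩ := h
  have := surjective_str F
  -- If `U` is the open set of definition in `D`, then `U × F` is open in both products. It is
  -- nonempty since `F` is surjective over `k`, so it contains both generic points.
  let s := f.source.ι ≫ D.str
  let j : pullback s F.str ⟶ pullback D.str F.str :=
    pullback.map s F.str D.str F.str f.source.ι (𝟙 _) (𝟙 _) (by simp [s]) (by simp)
  let j' : pullback s F.str ⟶ pullback D'.str F.str :=
    pullback.map s F.str D'.str F.str (f.iso.hom ≫ f.target.ι) (𝟙 _) (𝟙 _)
      (by simp [s, hf]) (by simp)
  have hj : IsOpenImmersion j := inferInstance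
  have hj' : IsOpenImmersion j' := inferInstance
  have hne : Nonempty ↑(pullback s F.str) := by
    obtain ⟨x, hx⟩ := f.dense_source.nonempty
    obtain ⟨w, -⟩ := (pullback.fst s F.str).surjective ⟨x, hx⟩
    exact ⟨w⟩
  obtain ⟨w, rfl, hw⟩ := exists_generic_preimage j hp
  obtain ⟨w', rfl, hw'⟩ := exists_generic_preimage j' hp'
  obtain rfl : w = w' := ((hw w').antisymm (hw' w)).eq
  refine (SameResidueField.of_isPreimmersion (sX := pullback.fst s F.str ≫ s) j ?_ w).symm.trans
    (SameResidueField.of_isPreimmersion j' ?_ w)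
  · rw [pullback.lift_fst_assoc, Category.assoc]
  · rw [pullback.lift_fst_assoc, Category.assoc, Category.assoc, hf]

/-! ### Birational triviality over a prime divisor -/

theorem range_redι (X : Scheme.{u}) : Set.range (redι X) = Set.univ := by
  rw [Scheme.IdealSheafData.range_subschemeι, Scheme.support_nilradical]
  rfl

/-- The generic point `ξ` of the irreducible preimage lies in the domain of the birational map to `D
× F`, which carries it to a generic point `p`. -/
theorem exists_generic_of_isBirationallyTrivialAt {k : Type u} [Field k] {X B : Variety k}
    {π : DominantHom X B} {F : Variety k} {ζ : B.X} (h : IsBirationallyTrivialAt π F ζ) :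
    ∃ ξ : X.X, closure {ξ} = π.hom ⁻¹' closure {ζ} ∧ π.hom ξ = ζ ∧
      ∃ p : ↑(pullback (B.subvariety ζ).str F.str), (∀ q, p ⤳ q) ∧
        SameResidueField X.str
          (pullback.fst (B.subvariety ζ).str F.str ≫ (B.subvariety ζ).str) ξ p := by
  obtain ⟨hirr, f, hf⟩ := h
  have := surjective_str F
  let Q := pullback π.hom (B.subvarietyι ζ)
  let P := pullback (B.subvariety ζ).str F.str
  have hfst : IsClosedImmersion (pullback.fst π.hom (B.subvarietyι ζ)) := inferInstance
  let i : Q.nilradical.subscheme ⟶ X.X := redι Q ≫ pullback.fst π.hom (B.subvarietyι ζ)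
  have hi : IsClosedImmersion i := inferInstance
  have hrange : Set.range i = π.hom ⁻¹' closure {ζ} := by
    rw [Scheme.Hom.comp_base, TopCat.coe_comp, Set.range_comp, range_redι, Set.image_univ,
      Scheme.Pullback.range_fst, range_subvarietyι]
  obtain ⟨ξ, hξ⟩ := QuasiSober.sober hirr (isClosed_closure.preimage π.hom.continuous)
  obtain ⟨q, rfl⟩ : ξ ∈ Set.range i := hrange ▸ hξ.mem
  have hq : ∀ q', q ⤳ q' := fun q' ↦ by
    refine i.isEmbedding.isInducing.specializes_iff.mp (hξ.specializes ?_)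
    rw [← hrange]
    exact ⟨q', rfl⟩
  have hqs : q ∈ f.source :=
    mem_of_forall_specializes hq f.source.2 (by
      have : Nonempty Q.nilradical.subscheme := ⟨q⟩
      exact f.dense_source.nonempty)
  obtain ⟨p, hp⟩ := exists_mapsPoint hqs
  have hpt : p ∈ f.target := hp.symm.mem_source
  have hp1 : ∀ p' ∈ f.target, p ⤳ p' := by
    intro p' hp'
    obtain ⟨q', z', rfl, rfl⟩ := exists_mapsPoint' hp'
    obtain ⟨z, rfl, rfl⟩ := hp
    refine Specializes.map ?_ (f.iso.hom ≫ f.target.ι).continuous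
    exact f.source.ι.isEmbedding.isInducing.specializes_iff.mp (hq _)
  -- The isomorphism controls only the open target; its density extends the specialization to all
  -- points.
  have hp2 : ∀ p', p ⤳ p' := by
    intro p'
    rw [specializes_iff_mem_closure]
    have h1 : closure (f.target : Set P.nilradical.subscheme) ⊆ closure {p} :=
      closure_minimal (fun y hy ↦ (hp1 y hy).mem_closure) isClosed_closure
    exact h1 (f.dense_target p')
  have hp3 : ∀ p', redι P p ⤳ p' := by
    intro p'
    obtain ⟨p', rfl⟩ : p' ∈ Set.range (redι P) := range_redι P ▸ trivial
    exact (hp2 p').map (redι P).continuous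
  have hres := hp.sameResidueField hf
  -- Since `D × F` surjects onto `D`, its generic point maps to that of `D`. The birational map is
  -- over `D`, so `ξ` also lies over `ζ`.
  have hD : (redι P ≫ pullback.fst (B.subvariety ζ).str F.str) p =
      genericPoint (B.subvariety ζ).X := by
    refine scheme_le_antisymm (le_genericPoint _) ?_
    obtain ⟨p', hp'⟩ := (pullback.fst (B.subvariety ζ).str F.str).surjective
      (genericPoint (B.subvariety ζ).X)
    have := (hp3 p').map (pullback.fst (B.subvariety ζ).str F.str).continuous
    rw [hp'] at this
    exact this
  have hqD : (redι Q ≫ pullback.snd π.hom (B.subvarietyι ζ)) q =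
      genericPoint (B.subvariety ζ).X := by
    rw [← hD]
    obtain ⟨z, rfl, rfl⟩ := hp
    rw [← Scheme.Hom.comp_apply, ← Scheme.Hom.comp_apply, Category.assoc, hf]
  refine ⟨i q, hξ.def, ?_, redι P p, hp3, ?_⟩
  · rw [← Scheme.Hom.comp_apply]
    have : i ≫ π.hom = (redι Q ≫ pullback.snd π.hom (B.subvarietyι ζ)) ≫ B.subvarietyι ζ := by
      simp only [i, Category.assoc, pullback.condition]
    rw [this, Scheme.Hom.comp_apply, hqD, subvarietyι_genericPoint]
  · refine (SameResidueField.of_isPreimmersion i rfl q).symm.trans ?_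
    have h1 := (hres.comp (B.subvariety ζ).str).trans
      (SameResidueField.of_isPreimmersion (redι P) (Category.assoc _ _ _).symm p)
    have h2 : i ≫ X.str = (redι Q ≫ pullback.snd π.hom (B.subvarietyι ζ)) ≫
        (B.subvariety ζ).str := by
      change _ = _ ≫ B.subvarietyι ζ ≫ B.str
      rw [← π.comp_str]
      simp only [i, Category.assoc, pullback.condition_assoc]
    rwa [h2]

/-! ### Vertical divisors of a birationally trivial morphism -/

section BirationallyTrivial

variable {k : Type u} [Field k] {X B : Variety k} {π : DominantHom X B} {F : Variety k}

instance (X : Variety k) : IsLocallyNoetherian X.X := LocallyOfFiniteType.isLocallyNoetherian X.str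

/-- The generic point `ξ` of the preimage has codimension at most that of `ζ`, and it is not generic
in `X` as its image `ζ` is not generic. Any other candidate over `ζ` specializes from `ξ`, so having
codimension one it equals `ξ`. -/
theorem IsBirationallyTrivialAt.exists_verticalPoint {ζ : B.X} (h : IsBirationallyTrivialAt π F ζ)
    (hζ : Order.coheight ζ = 1) :
    ∃ x ∈ verticalPoints π, π.hom x = ζ ∧ (∀ x' ∈ verticalPoints π, π.hom x' = ζ → x' = x) ∧
      ∃ p : ↑(pullback (B.subvariety ζ).str F.str), (∀ q, p ⤳ q) ∧
        SameResidueField X.str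
          (pullback.fst (B.subvariety ζ).str F.str ≫ (B.subvariety ζ).str) x p := by
  obtain ⟨ξ, hξ, rfl, hp⟩ := exists_generic_of_isBirationallyTrivialAt h
  have hmem : ∀ y, π.hom y = π.hom ξ → ξ ⤳ y := fun y hy ↦ by
    rw [specializes_iff_mem_closure, hξ]
    change π.hom y ∈ closure {π.hom ξ}
    rw [hy]
    exact subset_closure rfl
  have hne : π.hom ξ ≠ genericPoint B.X := (coheight_eq_one_iff.mp hζ).1
  have hle : Order.coheight ξ ≤ 1 := hζ ▸ coheight_le_of_forall_specializes π.hom ξ fun y hy hy' ↦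
    scheme_le_antisymm (hmem y hy') hy
  have hge : Order.coheight ξ ≠ 0 := fun h0 ↦ by
    have h1 : ξ = genericPoint X.X := scheme_le_antisymm (le_genericPoint _)
      (Order.coheight_eq_zero.mp h0 (le_genericPoint _))
    exact hne (h1 ▸ apply_genericPoint_of_isDominant π.hom)
  refine ⟨ξ, ⟨le_antisymm hle (Order.one_le_iff_ne_zero.mpr hge), hne⟩, rfl, ?_, hp⟩
  intro x hx hxξ
  rcases (coheight_eq_one_iff.mp hx.1).2 ξ (hmem x hxξ) with h | h
  · exact h.symm
  · exact absurd (h ▸ apply_genericPoint_of_isDominant π.hom) hne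

variable (π F) in
/-- The vertical points lying over prime divisors at which `π` is birationally trivial. -/
def trivialPoints : Set X.X :=
  {x ∈ verticalPoints π | Order.coheight (π.hom x) = 1 ∧ IsBirationallyTrivialAt π F (π.hom x)}

theorem injOn_trivialPoints : Set.InjOn π.hom (trivialPoints π F) := by
  intro x hx y hy hxy
  obtain ⟨z, -, -, hz, -⟩ := hx.2.2.exists_verticalPoint hx.2.1
  rw [hz x hx.1 rfl, hz y hy.1 hxy.symm]

theorem image_trivialPoints : π.hom '' trivialPoints π F =
    {ζ | Order.coheight ζ = 1 ∧ IsBirationallyTrivialAt π F ζ} := by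
  ext ζ
  constructor
  · rintro ⟨x, hx, rfl⟩
    exact hx.2
  · rintro ⟨h1, h2⟩
    obtain ⟨x, hx, rfl, -⟩ := h2.exists_verticalPoint h1
    exact ⟨x, ⟨hx, h1, h2⟩, rfl⟩

/-- Equal basis elements of the Burnside group mean birational divisors of `B`, whose products with
`F` have the same generic residue field. This makes `pullbackClass` well defined. -/
theorem pointClass_eq_of_mem_trivialPoints {x y : X.X} (hx : x ∈ trivialPoints π F)
    (hy : y ∈ trivialPoints π F) (h : pointClass B (π.hom x) = pointClass B (π.hom y)) :
    pointClass X x = pointClass X y := by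
  obtain ⟨x', -, -, hx', p, hp, hxp⟩ := hx.2.2.exists_verticalPoint hx.2.1
  obtain ⟨y', -, -, hy', q, hq, hyq⟩ := hy.2.2.exists_verticalPoint hy.2.1
  obtain rfl := hx' x hx.1 rfl
  obtain rfl := hy' y hy.1 rfl
  have hbir : Scheme.BirationalOver (B.subvariety (π.hom x)).str (B.subvariety (π.hom y)).str :=
    Quotient.exact (s := birationalSetoid k) (FreeAbelianGroup.of_injective h)
  exact Burn.cls_subvariety_eq
    ((hxp.trans (sameResidueField_pullback hbir hp hq)).trans hyq.symm)

open Classical in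
variable (π F) in
/-- The homomorphism sending the class of a prime divisor `D` of `B` at which `π` is birationally
trivial to the class of `π⁻¹(D)`. -/
noncomputable def pullbackClass : Burn k →+ Burn k :=
  -- A product with `F` need not be integral, so the value is read off a chosen divisor of `X`. The
  -- default `0` is never used, as the map is only evaluated on classes of images of trivial points.
  FreeAbelianGroup.lift fun q ↦
    if h : ∃ x ∈ trivialPoints π F, pointClass B (π.hom x) = FreeAbelianGroup.of q then
      pointClass X h.choose else 0

theorem pullbackClass_pointClass {x : X.X} (hx : x ∈ trivialPoints π F) :
    pullbackClass π F (pointClass B (π.hom x)) = pointClass X x := by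
  have h : ∃ y ∈ trivialPoints π F, pointClass B (π.hom y) = FreeAbelianGroup.of
    (Quotient.mk (birationalSetoid k) (B.subvariety (π.hom x))) := ⟨x, hx, rfl⟩
  refine (FreeAbelianGroup.lift_apply_of _ _).trans ?_
  rw [dif_pos h]
  exact pointClass_eq_of_mem_trivialPoints h.choose_spec.1 hx h.choose_spec.2

/-- By flatness a discarded point lies over one of the finitely many bad divisors of `B`. The
preimage of such a divisor is a proper closed subset, which contains finitely many points of
codimension one. -/
theorem IsBirationallyTrivialInCodimOne.finite_verticalPoints_diff
    (h : IsBirationallyTrivialInCodimOne π F) :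
    (verticalPoints π \ trivialPoints π F).Finite := by
  have := h.flat
  refine (h.finite.biUnion (t := fun ζ ↦ {x | Order.coheight x = 1 ∧
    x ∉ (⟨(π.hom ⁻¹' closure {ζ})ᶜ, (isClosed_closure.preimage π.hom.continuous).isOpen_compl⟩ :
      X.X.Opens)}) fun ζ hζ ↦ ?_).subset ?_
  · refine finite_of_notMem_source _ (Opens.isOpen _ |>.dense ⟨genericPoint X.X, fun hη ↦ ?_⟩)
    change π.hom (genericPoint X.X) ∈ closure {ζ} at hη
    rw [apply_genericPoint_of_isDominant, ← specializes_iff_mem_closure] at hη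
    exact (coheight_eq_one_iff.mp hζ.1).1 (scheme_le_antisymm (le_genericPoint _) hη)
  · rintro x ⟨hx, hx'⟩
    have h1 := coheight_eq_one_of_flat π.hom hx.1 hx.2
    refine Set.mem_biUnion (x := π.hom x) ⟨h1, fun h2 ↦ hx' ⟨hx, h1, h2⟩⟩ ⟨hx.1, fun hn ↦ hn ?_⟩
    exact subset_closure (Set.mem_singleton _)

/-- Both indices are reduced to trivial points and their images, where `π` is injective and carries
a cofinite subgraph for `φ` to one for the base map. -/
theorem IsBirationallyTrivialInCodimOne.cVer_eq (h : IsBirationallyTrivialInCodimOne π F)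
    (φ : SquareBirMap π π) : φ.cVer = pullbackClass π F φ.base.c := by
  obtain ⟨G, hG, hbase, hcls, hc⟩ := φ.cVer_eq_graphIndex
  let V := trivialPoints π F
  have hVfin : (verticalPoints π \ V).Finite := h.finite_verticalPoints_diff
  have hVsub : V ⊆ verticalPoints π := fun x hx ↦ hx.1
  let G₁ := {g ∈ G | g.1 ∈ V ∧ g.2 ∈ V}
  have hG₁ : IsCofiniteGraph (verticalPoints π) (verticalPoints π) G₁ := hG.restrict hVfin hVfin
  have hG₁V : IsCofiniteGraph V V G₁ :=
    { fst_mem := fun g hg ↦ hg.2.1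
      snd_mem := fun g hg ↦ hg.2.2
      fst_inj := hG₁.fst_inj
      snd_inj := hG₁.snd_inj
      finite_fst := hG₁.finite_fst.subset fun x hx ↦ ⟨hVsub hx.1, hx.2⟩
      finite_snd := hG₁.finite_snd.subset fun x hx ↦ ⟨hVsub hx.1, hx.2⟩ }
  have hinj : Set.InjOn π.hom V := injOn_trivialPoints
  have hGB := isCofiniteGraph_codimOneGraph φ.base.toPartialIso
  let G₂ := Prod.map π.hom π.hom '' G₁
  have hG₂V : IsCofiniteGraph (π.hom '' V) (π.hom '' V) G₂ := hG₁V.image hinj hinj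
  have hVB : π.hom '' V ⊆ codimOne B.X := by
    rintro _ ⟨x, hx, rfl⟩
    exact hx.2.1
  have hVBfin : (codimOne B.X \ π.hom '' V).Finite := by
    refine h.finite.subset ?_
    rintro ζ ⟨hζ, hζ'⟩
    exact ⟨hζ, fun h1 ↦ hζ' (image_trivialPoints.ge ⟨hζ, h1⟩)⟩
  have hG₂ : IsCofiniteGraph (codimOne B.X) (codimOne B.X) G₂ :=
    { fst_mem := fun g hg ↦ hVB (hG₂V.fst_mem g hg)
      snd_mem := fun g hg ↦ hVB (hG₂V.snd_mem g hg)
      fst_inj := hG₂V.fst_inj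
      snd_inj := hG₂V.snd_inj
      -- A codimension-one point of `B` missed by `G₂` is either outside `π(V)` or missed within
      -- `π(V)`, and both sets are finite.
      finite_fst := (hVBfin.union hG₂V.finite_fst).subset fun b hb ↦
        (Classical.em (b ∈ π.hom '' V)).elim (fun h ↦ Or.inr ⟨h, hb.2⟩) fun h ↦ Or.inl ⟨hb.1, h⟩
      finite_snd := (hVBfin.union hG₂V.finite_snd).subset fun b hb ↦
        (Classical.em (b ∈ π.hom '' V)).elim (fun h ↦ Or.inr ⟨h, hb.2⟩) fun h ↦ Or.inl ⟨hb.1, h⟩ }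
  have hG₂B : G₂ ⊆ codimOneGraph φ.base.toPartialIso := by
    rintro _ ⟨g, hg, rfl⟩
    exact ⟨hg.2.1.2.1, hbase g hg.1⟩
  have hpush := map_graphIndex_image hG₁V hinj hinj (d := pointClass B) (d' := pointClass B)
    (AddMonoidHom.id _) (pullbackClass π F) (fun x hx ↦ (pullbackClass_pointClass hx).symm)
    fun x hx ↦ (pullbackClass_pointClass hx).symm
  -- On each side the graph is shrunk and the ambient set is then cut down, to `V` on `X` and to
  -- `π(V)` on `B`; `hpush` compares the two results.
  rw [hc, ← hG.graphIndex_eq hG₁ (fun g hg ↦ hg.1) hcls,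
    graphIndex_eq_of_subset hVsub (fun g hg ↦ hg.2.1) (fun g hg ↦ hg.2.2) hG₁.finite_fst
      hG₁.finite_snd, φ.base.c_eq_graphIndex,
    ← hGB.graphIndex_eq hG₂ hG₂B fun g hg ↦
      (Burn.cls_subvariety_eq (hg.2.sameResidueField φ.base.isOver)).symm,
    graphIndex_eq_of_subset hVB hG₂V.fst_mem hG₂V.snd_mem hG₂.finite_fst hG₂.finite_snd]
  exact hpush

end BirationallyTrivial

end MotivicBir

theorem mainTheorem9 {k : Type u} [Field k] {X B : MotivicBir.Variety k}
    (π : MotivicBir.DominantHom X B)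
    (hπ : ∃ F : MotivicBir.Variety k, MotivicBir.IsBirationallyTrivialInCodimOne π F)
    (hB : ∀ σ : MotivicBir.BirMap B B, σ.c = 0)
    (φ : MotivicBir.SquareBirMap π π) :
    φ.cVer = 0 := by
  obtain ⟨F, hF⟩ := hπ
  rw [hF.cVer_eq φ, hB, map_zero]
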